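/- Composition is written in diagrammatic order: $fg$ is "first $f$, then $g$". **Setting.** Let $p:\mathcal D\to\mathcal C$ be a functor. The category $\mathcal C$ is *factorization preordered* (FP) if for all arrows $f:W\to X$, $g,h:X\to Y$, $k:Y\to Z$, the equations $fg=fh$ and $gk=hk$ imply $g=h$. *Formulas* over objects of $\mathcal C$ are generated by: an atom $X$ over $p(X)$ for each object $X$ of $\mathcal D$; $\mathrm{push}_f S$ over $B$ for $f:A\to B$ and $S$ over $A$; $\mathrm{pull}_g T$ over $A$ for $g:A\to B$ and $T$ over $B$. *Derivations* of sequents $S\vdash_h T$ ($S$ over $A$, $T$ over $B$, $h:A\to B$) are generated by the axioms $X\vdash_{p(\delta)}Y$ for the arrows $\delta:X\to Y$ of $\mathcal D$, and the rules $$\mathrm{L}_{\rm push}[f]:\ \frac{S\vdash_{fg}T}{\mathrm{push}_fS\vdash_{g}T}\qquad \mathrm{R}_{\rm push}[f]:\ \frac{S\vdash_{g}T}{S\vdash_{gf}\mathrm{push}_fT}\qquad \mathrm{L}_{\rm pull}[f]:\ \frac{S\vdash_{g}T}{\mathrm{pull}_fS\vdash_{fg}T}\qquad \mathrm{R}_{\rm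 pull}[f]:\ \frac{S\vdash_{gf}T}{S\vdash_{g}\mathrm{pull}_fT}$$ *Permutation equivalence* is the least congruence on derivations that identifies, for each of the four choices of a left rule $\mathrm L$ and a right rule $\mathrm R$ and all arrows that make both sides well formed, "$\mathrm L$ followed by $\mathrm R$" with "$\mathrm R$ followed by $\mathrm L$" (same premise, same conclusion). The free bifibration $\mathrm{Bif}(p)\to\mathcal C$ has as objects the formulas, as arrows $S\to T$ the pairs of an arrow $f$ of $\mathcal C$ and a permutation class of derivations of $S\vdash_fT$, and composition is given by (admissible) cut; the projection sends a formula over $A$ to $A$ and an arrow to its arrow $f$ of $\mathcal C$. **Maximally multifocused proofs.** For a finite composable sequence of arrows $\pi=(f_1,\dots,f_n)$, $n\ge0$, put $\mathrm{push}_\pi S=\mathrm{push}_{f_n}\cdots\mathrm{push}_{f_1}S$ and $\mathrm{pull}_\pi S=\mathrm{pull}_{f_1}\cdots\mathrm{pull}_{f_n}S$; inside a base arrow $\pi$ also denotes the composite $f_1\cdots f_n$ (an identity if $n=0$). Write $N,M$ for formulas that are not push formulas and $P,Q$ for formulas that are not pull formulas. Write $(a,b)\le(c,d)$ if there is an arrow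 $e$ with $c=ae$ and $b=ed$. A *state* $q$ is either a pre-inversion state $\cdot$ (unlocked), $L$, $R$, or a pre-focus state $\bot$, $L[\pi,f]$, $R[f,\rho]$, where $\pi f$, respectively $f\rho$, is defined. Maximally multifocused proofs of sequents $S\vdash_f^qT$ are generated by the following rules, written "premise $\Longrightarrow$ conclusion". Axioms and focusing rules, where $q$ is a pre-focus state and $\sigma,\tau$ are non-empty: - $X\vdash^q_{p(\delta)}Y$ for each arrow $\delta:X\to Y$ of $\mathcal D$; - $P\vdash^L_gQ\ \Longrightarrow\ \mathrm{pull}_\sigma P\vdash^q_{\sigma g}Q$, provided that $(\sigma,g)\not\le(f,\rho)$ if $q=R[f,\rho]$; - $N\vdash^R_gM\ \Longrightarrow\ N\vdash^q_{g\tau}\mathrm{push}_\tau M$, provided that $(\pi,f)\not\le(g,\tau)$ if $q=L[\pi,f]$; - $P\vdash^{\cdot}_gN\ \Longrightarrow\ \mathrm{pull}_\sigma P\vdash^q_{\sigma g\tau}\mathrm{push}_\tau N$, provided that $(\pi,f)\not\le(\sigma g,\tau)$ if $q=L[\pi,f]$, and $(\sigma,g\tau)\not\le(f,\rho)$ if $q=R[f,\rho]$.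 Inversion rules, where $\pi,\rho$ may be empty (so exactly one of these steps applies to the sequents in a pre-inversion state that arise in a proof): - $N\vdash^{\bot}_{\pi f\rho}P\ \Longrightarrow\ \mathrm{push}_\pi N\vdash^{\cdot}_f\mathrm{pull}_\rho P$; - $N\vdash^{L[\pi,f]}_{\pi f}P\ \Longrightarrow\ \mathrm{push}_\pi N\vdash^{L}_fP$; - $N\vdash^{R[f,\rho]}_{f\rho}P\ \Longrightarrow\ N\vdash^{R}_f\mathrm{pull}_\rho P$. Such a proof has an *underlying derivation* of $S\vdash_fT$: forget the states, replace each rule along a sequence by the corresponding rules for its arrows one after the other, and each two-sided rule by the rules on one side followed by those on the other (either order gives the same permutation class). **Theorem.** Let $\mathcal C$ be factorization preordered, $S$ a formula over $A$, $T$ a formula over $B$, and $f:A\to B$ an arrow of $\mathcal C$. Sending a maximally multifocused proof to the permutation class of its underlying derivation defines a bijection from the set of maximally multifocused proofs of $S\vdash^{\cdot}_fT$ (unlocked state) onto the set of arrows $\alpha:S\to T$ of $\mathrm{Bif}(p)$ lying over $f$. In particular these proofs, which are generated inductively with no quotient, describe the relative homsets of $\mathrm{Bif}(p)$. -/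

import Mathlib

open CategoryTheory

universe v₁ v₂ u₁ u₂

/-- A category is *factorization preordered* if every commuting square has at most one diagonal
filler, i.e. every category of factorizations is a preorder. -/
def FactorizationPreordered (C : Type u₁) [Category.{v₁} C] : Prop :=
  ∀ ⦃W X Y Z : C⦄ (f : W ⟶ X) (g h : X ⟶ Y) (k : Y ⟶ Z),
    f ≫ g = f ≫ h → g ≫ k = h ≫ k → g = h

namespace FreeBif

variable {C : Type u₁} [Category.{v₁} C] {D : Type u₂} [Category.{v₂} D]

/-- Bifibrational formulas `S ⊏ A` on a functor `p : D ⥤ C`: atoms, pushforwards, pullbacks. -/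
inductive Frm (p : D ⥤ C) : C → Type (max u₁ v₁ u₂)
  | atom {A : C} (X : D) (hX : p.obj X = A) : Frm p A
  | push {A B : C} (f : A ⟶ B) (S : Frm p A) : Frm p B
  | pull {A B : C} (g : A ⟶ B) (T : Frm p B) : Frm p A

variable {p : D ⥤ C}

/-- `Deriv S T h` is the type of (closed, cut-free) derivations of the sequent `S ⊢_h T`.
Equations between base arrows are carried as hypotheses of the rules.  `p.IsHomLift f δ` is
Mathlib's way to say `p(δ) = f`. -/
inductive Deriv : {A B : C} → Frm p A → Frm p B → (A ⟶ B) → Type (max u₁ v₁ u₂ v₂)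
  | ax {A B : C} {X Y : D} {hX : p.obj X = A} {hY : p.obj Y = B} {f : A ⟶ B}
      (δ : X ⟶ Y) (hδ : p.IsHomLift f δ) : Deriv (.atom X hX) (.atom Y hY) f
  | pushL {A B E : C} {S : Frm p A} {T : Frm p E} (f : A ⟶ B) {g : B ⟶ E} {h : A ⟶ E}
      (α : Deriv S T h) (e : f ≫ g = h) : Deriv (.push f S) T g
  | pushR {A B E : C} {S : Frm p A} {T : Frm p B} (f : B ⟶ E) {g : A ⟶ B} {h : A ⟶ E}
      (α : Deriv S T g) (e : g ≫ f = h) : Deriv S (.push f T) h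
  | pullL {A B E : C} {S : Frm p B} {T : Frm p E} (f : A ⟶ B) {g : B ⟶ E} {h : A ⟶ E}
      (α : Deriv S T g) (e : f ≫ g = h) : Deriv (.pull f S) T h
  | pullR {A B E : C} {S : Frm p A} {T : Frm p E} (f : B ⟶ E) {g : A ⟶ B} {h : A ⟶ E}
      (α : Deriv S T h) (e : g ≫ f = h) : Deriv S (.pull f T) g

open Deriv

/-- Permutation equivalence: the least congruence on derivations containing the four
permutations of a left rule with a right rule. -/
inductive PermEq : {A B : C} → {S : Frm p A} → {T : Frm p B} → {h : A ⟶ B} →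
    Deriv S T h → Deriv S T h → Prop
  | refl {A B : C} {S : Frm p A} {T : Frm p B} {h : A ⟶ B} (α : Deriv S T h) : PermEq α α
  | symm {A B : C} {S : Frm p A} {T : Frm p B} {h : A ⟶ B} {α β : Deriv S T h} :
      PermEq α β → PermEq β α
  | trans {A B : C} {S : Frm p A} {T : Frm p B} {h : A ⟶ B} {α β γ : Deriv S T h} :
      PermEq α β → PermEq β γ → PermEq α γ
  | congr_pushL {A B E : C} {S : Frm p A} {T : Frm p E} {f : A ⟶ B} {g : B ⟶ E} {h : A ⟶ E}
      {α β : Deriv S T h} (e : f ≫ g = h) :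
      PermEq α β → PermEq (pushL f α e) (pushL f β e)
  | congr_pushR {A B E : C} {S : Frm p A} {T : Frm p B} {f : B ⟶ E} {g : A ⟶ B} {h : A ⟶ E}
      {α β : Deriv S T g} (e : g ≫ f = h) :
      PermEq α β → PermEq (pushR f α e) (pushR f β e)
  | congr_pullL {A B E : C} {S : Frm p B} {T : Frm p E} {f : A ⟶ B} {g : B ⟶ E} {h : A ⟶ E}
      {α β : Deriv S T g} (e : f ≫ g = h) :
      PermEq α β → PermEq (pullL f α e) (pullL f β e)
  | congr_pullR {A B E : C} {S : Frm p A} {T : Frm p E} {f : B ⟶ E} {g : A ⟶ B} {h : A ⟶ E}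
      {α β : Deriv S T h} (e : g ≫ f = h) :
      PermEq α β → PermEq (pullR f α e) (pullR f β e)
  | pullL_pushR {A B E F : C} {S : Frm p B} {T : Frm p E} {f : A ⟶ B} {g : B ⟶ E} {h : E ⟶ F}
      {fg : A ⟶ E} {gh : B ⟶ F} {fgh : A ⟶ F} (α : Deriv S T g)
      (e₁ : f ≫ g = fg) (e₂ : fg ≫ h = fgh) (e₃ : g ≫ h = gh) (e₄ : f ≫ gh = fgh) :
      PermEq (pushR h (pullL f α e₁) e₂) (pullL f (pushR h α e₃) e₄)
  | pushL_pushR {A B E F : C} {S : Frm p A} {T : Frm p E} {f : A ⟶ B} {g : B ⟶ E} {h : E ⟶ F}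
      {fg : A ⟶ E} {gh : B ⟶ F} {fgh : A ⟶ F} (α : Deriv S T fg)
      (e₁ : f ≫ g = fg) (e₂ : g ≫ h = gh) (e₃ : fg ≫ h = fgh) (e₄ : f ≫ gh = fgh) :
      PermEq (pushR h (pushL f α e₁) e₂) (pushL f (pushR h α e₃) e₄)
  | pullL_pullR {A B E F : C} {S : Frm p B} {T : Frm p F} {f : A ⟶ B} {g : B ⟶ E} {h : E ⟶ F}
      {fg : A ⟶ E} {gh : B ⟶ F} {fgh : A ⟶ F} (α : Deriv S T gh)
      (e₁ : f ≫ gh = fgh) (e₂ : fg ≫ h = fgh) (e₃ : g ≫ h = gh) (e₄ : f ≫ g = fg) :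
      PermEq (pullR h (pullL f α e₁) e₂) (pullL f (pullR h α e₃) e₄)
  | pushL_pullR {A B E F : C} {S : Frm p A} {T : Frm p F} {f : A ⟶ B} {g : B ⟶ E} {h : E ⟶ F}
      {fg : A ⟶ E} {gh : B ⟶ F} {fgh : A ⟶ F} (α : Deriv S T fgh)
      (e₁ : f ≫ gh = fgh) (e₂ : g ≫ h = gh) (e₃ : fg ≫ h = fgh) (e₄ : f ≫ g = fg) :
      PermEq (pullR h (pushL f α e₁) e₂) (pushL f (pullR h α e₃) e₄)

instance permSetoid {A B : C} (S : Frm p A) (T : Frm p B) (h : A ⟶ B) :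
    Setoid (Deriv S T h) where
  r := PermEq
  iseqv := ⟨.refl, .symm, .trans⟩

/-! ### Identity and cut -/

/-- The identity derivation. -/
def idDeriv : {A : C} → (S : Frm p A) → Deriv S S (𝟙 A)
  | _, .atom X hX => .ax (𝟙 X) (IsHomLift.id hX)
  | _, .push f S => .pushL f (.pushR f (idDeriv S) (Category.id_comp f)) (Category.comp_id f)
  | _, .pull g T => .pullR g (.pullL g (idDeriv T) (Category.comp_id g)) (Category.id_comp g)

/-- The admissible cut rule, from `S ⊢_g T` and `T ⊢_h U` to `S ⊢_{gh} U`.  Where several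
reductions apply, the left one is taken first; the other choices give permutation equivalent
results. -/
def cut : {A B E : C} → {S : Frm p A} → {T : Frm p B} → {U : Frm p E} → {g : A ⟶ B} →
    {h : B ⟶ E} → {k : A ⟶ E} → Deriv S T g → Deriv T U h → g ≫ h = k → Deriv S U k
  | _, _, _, _, _, _, _, h, _, .pullL f α e, β, w =>
      .pullL f (cut α β rfl) (by rw [← w, ← e, Category.assoc])
  | _, _, _, _, _, _, _, h, _, .pushL f α e, β, w =>
      .pushL f (cut α β rfl) (by rw [← w, ← e, Category.assoc])
  | _, _, _, _, _, _, _, _, _, .ax δ hδ, .ax ε hε, w =>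
      .ax (δ ≫ ε) (by subst w; infer_instance)
  | _, _, _, _, _, _, _, _, _, .ax δ hδ, .pushR f β e, w =>
      .pushR f (cut (.ax δ hδ) β rfl) (by rw [← w, ← e, Category.assoc])
  | _, _, _, _, _, _, _, _, _, .ax δ hδ, .pullR f β e, w =>
      .pullR f (cut (.ax δ hδ) β rfl) (by rw [← w, ← e, Category.assoc])
  | _, _, _, _, _, _, _, _, _, .pushR _ α e, .pushL _ β e', w =>
      cut α β (by rw [← w, ← e, ← e', Category.assoc])
  | _, _, _, _, _, _, _, _, _, .pushR f' α e', .pushR f β e, w =>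
      .pushR f (cut (.pushR f' α e') β rfl) (by rw [← w, ← e, Category.assoc])
  | _, _, _, _, _, _, _, _, _, .pushR f' α e', .pullR f β e, w =>
      .pullR f (cut (.pushR f' α e') β rfl) (by rw [← w, ← e, Category.assoc])
  | _, _, _, _, _, _, _, _, _, .pullR _ α e, .pullL _ β e', w =>
      cut α β (by rw [← w, ← e, ← e', Category.assoc])
  | _, _, _, _, _, _, _, _, _, .pullR f' α e', .pushR f β e, w =>
      .pushR f (cut (.pullR f' α e') β rfl) (by rw [← w, ← e, Category.assoc])
  | _, _, _, _, _, _, _, _, _, .pullR f' α e', .pullR f β e, w =>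
      .pullR f (cut (.pullR f' α e') β rfl) (by rw [← w, ← e, Category.assoc])
termination_by _ _ _ _ _ _ _ _ _ α β => sizeOf α + sizeOf β

/-! ### Cut is compatible with permutation equivalence, unital and associative -/

section CutLemmas

set_option linter.unusedSimpArgs false

variable {A B E F : C}

theorem cut_pushL {S : Frm p A} {T : Frm p E} {U : Frm p F} {f : A ⟶ B} {g : B ⟶ E}
    {fg : A ⟶ E} {h : E ⟶ F} {gh : B ⟶ F} {k : A ⟶ F} (α : Deriv S T fg) (e : f ≫ g = fg)
    (β : Deriv T U h) (w : g ≫ h = gh) (w' : fg ≫ h = k) (e' : f ≫ gh = k) :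
    cut (pushL f α e) β w = pushL f (cut α β w') e' := by
  subst w'; rw [cut]

theorem cut_pullL {S : Frm p B} {T : Frm p E} {U : Frm p F} {f : A ⟶ B} {g : B ⟶ E}
    {fg : A ⟶ E} {h : E ⟶ F} {gh : B ⟶ F} {k : A ⟶ F} (α : Deriv S T g) (e : f ≫ g = fg)
    (β : Deriv T U h) (w : fg ≫ h = k) (w' : g ≫ h = gh) (e' : f ≫ gh = k) :
    cut (pullL f α e) β w = pullL f (cut α β w') e' := by
  subst w'; rw [cut]

theorem cut_pushR {S : Frm p A} {T : Frm p B} {U : Frm p E} {g : A ⟶ B} {h : B ⟶ E}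
    {f : E ⟶ F} {hf : B ⟶ F} {gh : A ⟶ E} {k : A ⟶ F} (α : Deriv S T g) (β : Deriv T U h)
    (e : h ≫ f = hf) (w : g ≫ hf = k) (v : g ≫ h = gh) (w' : gh ≫ f = k) :
    PermEq (cut α (pushR f β e) w) (pushR f (cut α β v) w') := by
  subst v
  induction α with
  | ax δ hδ => rw [cut]; exact .refl _
  | pushR f' α e' ih => rw [cut]; exact .refl _
  | pullR f' α e' ih => rw [cut]; exact .refl _
  | pushL f' α e' ih =>
      rw [cut, cut]
      refine .trans (.congr_pushL _ (ih β e rfl (by simp [← e]))) ?_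
      exact .symm (.pushL_pushR _ _ _ _ _)
  | pullL f' α e' ih =>
      rw [cut, cut]
      refine .trans (.congr_pullL _ (ih β e rfl (by simp [← e]))) ?_
      exact .symm (.pullL_pushR _ _ _ _ _)

theorem cut_pullR {S : Frm p A} {T : Frm p B} {U : Frm p F} {g : A ⟶ B} {h : B ⟶ E}
    {f : E ⟶ F} {hf : B ⟶ F} {k : A ⟶ E} {l : A ⟶ F} (α : Deriv S T g) (β : Deriv T U hf)
    (e : h ≫ f = hf) (w : g ≫ h = k) (v : g ≫ hf = l) (w' : k ≫ f = l) :
    PermEq (cut α (pullR f β e) w) (pullR f (cut α β v) w') := by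
  subst v
  induction α with
  | ax δ hδ => rw [cut]; exact .refl _
  | pushR f' α e' ih => rw [cut]; exact .refl _
  | pullR f' α e' ih => rw [cut]; exact .refl _
  | pushL f' α e' ih =>
      rw [cut, cut]
      refine .trans (.congr_pushL _ (ih β e rfl (by simp [← e]))) ?_
      exact .symm (.pushL_pullR _ _ _ _ _)
  | pullL f' α e' ih =>
      rw [cut, cut]
      refine .trans (.congr_pullL _ (ih β e rfl (by simp [← e]))) ?_
      exact .symm (.pullL_pullR _ _ _ _ _)

theorem pushL_cut_refl {S : Frm p A} {T : Frm p E} {U : Frm p F} {f : A ⟶ B} {g : B ⟶ F}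
    {fg : A ⟶ E} {h : E ⟶ F} {k k' : A ⟶ F} (α : Deriv S T fg) (β : Deriv T U h)
    (w : fg ≫ h = k) (w' : fg ≫ h = k') (e : f ≫ g = k) (e' : f ≫ g = k') :
    PermEq (pushL f (cut α β w) e) (pushL f (cut α β w') e') := by
  subst w; subst w'; exact .refl _

theorem pullL_cut_refl {S : Frm p B} {T : Frm p E} {U : Frm p F} {f : A ⟶ B} {g : B ⟶ E}
    {h : E ⟶ F} {k k' : B ⟶ F} {l : A ⟶ F} (α : Deriv S T g) (β : Deriv T U h)
    (w : g ≫ h = k) (w' : g ≫ h = k') (e : f ≫ k = l) (e' : f ≫ k' = l) :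
    PermEq (pullL f (cut α β w) e) (pullL f (cut α β w') e') := by
  subst w; subst w'; exact .refl _

theorem ind_target_push {B E : C} {φ : B ⟶ E} {Q : Frm p B}
    {motive : ∀ {A : C} {R : Frm p A} {g : A ⟶ E}, Deriv R (.push φ Q) g → Prop}
    (hpushL : ∀ {A B : C} {R : Frm p A} {f : A ⟶ B} {g : B ⟶ E} {h : A ⟶ E}
      (α : Deriv R (.push φ Q) h) (e : f ≫ g = h), motive α → motive (pushL f α e))
    (hpullL : ∀ {A B : C} {R : Frm p B} {f : A ⟶ B} {g : B ⟶ E} {h : A ⟶ E}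
      (α : Deriv R (.push φ Q) g) (e : f ≫ g = h), motive α → motive (pullL f α e))
    (hmain : ∀ {A : C} {R : Frm p A} {g : A ⟶ B} {h : A ⟶ E} (α : Deriv R Q g)
      (e : g ≫ φ = h), motive (pushR φ α e)) :
    ∀ {A : C} {R : Frm p A} {g : A ⟶ E} (α : Deriv R (.push φ Q) g), motive α
  | _, _, _, .pushL f α e => hpushL α e (ind_target_push hpushL hpullL hmain α)
  | _, _, _, .pullL f α e => hpullL α e (ind_target_push hpushL hpullL hmain α)
  | _, _, _, .pushR _ α e => hmain α e

theorem ind_target_pull {E F : C} {φ : E ⟶ F} {Q : Frm p F}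
    {motive : ∀ {A : C} {R : Frm p A} {g : A ⟶ E}, Deriv R (.pull φ Q) g → Prop}
    (hpushL : ∀ {A B : C} {R : Frm p A} {f : A ⟶ B} {g : B ⟶ E} {h : A ⟶ E}
      (α : Deriv R (.pull φ Q) h) (e : f ≫ g = h), motive α → motive (pushL f α e))
    (hpullL : ∀ {A B : C} {R : Frm p B} {f : A ⟶ B} {g : B ⟶ E} {h : A ⟶ E}
      (α : Deriv R (.pull φ Q) g) (e : f ≫ g = h), motive α → motive (pullL f α e))
    (hmain : ∀ {A : C} {R : Frm p A} {g : A ⟶ E} {h : A ⟶ F} (α : Deriv R Q h)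
      (e : g ≫ φ = h), motive (pullR φ α e)) :
    ∀ {A : C} {R : Frm p A} {g : A ⟶ E} (α : Deriv R (.pull φ Q) g), motive α
  | _, _, _, .pushL f α e => hpushL α e (ind_target_pull hpushL hpullL hmain α)
  | _, _, _, .pullL f α e => hpullL α e (ind_target_pull hpushL hpullL hmain α)
  | _, _, _, .pullR _ α e => hmain α e

theorem ind_target_atom {E : C} {X : D} {hX : p.obj X = E}
    {motive : ∀ {A : C} {R : Frm p A} {g : A ⟶ E}, Deriv R (.atom X hX) g → Prop}
    (hpushL : ∀ {A B : C} {R : Frm p A} {f : A ⟶ B} {g : B ⟶ E} {h : A ⟶ E}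
      (α : Deriv R (.atom X hX) h) (e : f ≫ g = h), motive α → motive (pushL f α e))
    (hpullL : ∀ {A B : C} {R : Frm p B} {f : A ⟶ B} {g : B ⟶ E} {h : A ⟶ E}
      (α : Deriv R (.atom X hX) g) (e : f ≫ g = h), motive α → motive (pullL f α e))
    (hmain : ∀ {A : C} {Y : D} {hY : p.obj Y = A} {g : A ⟶ E} (δ : Y ⟶ X)
      (hδ : p.IsHomLift g δ), motive (Deriv.ax (hX := hY) (hY := hX) δ hδ)) :
    ∀ {A : C} {R : Frm p A} {g : A ⟶ E} (α : Deriv R (.atom X hX) g), motive α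
  | _, _, _, .pushL f α e => hpushL α e (ind_target_atom hpushL hpullL hmain α)
  | _, _, _, .pullL f α e => hpullL α e (ind_target_atom hpushL hpullL hmain α)
  | _, _, _, .ax δ hδ => hmain δ hδ

theorem ind_source_push {Z A : C} {φ : Z ⟶ A} {Q : Frm p Z}
    {motive : ∀ {B : C} {R : Frm p B} {g : A ⟶ B}, Deriv (.push φ Q) R g → Prop}
    (hpushR : ∀ {B E : C} {R : Frm p B} {f : B ⟶ E} {g : A ⟶ B} {h : A ⟶ E}
      (α : Deriv (.push φ Q) R g) (e : g ≫ f = h), motive α → motive (pushR f α e))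
    (hpullR : ∀ {B E : C} {R : Frm p E} {f : B ⟶ E} {g : A ⟶ B} {h : A ⟶ E}
      (α : Deriv (.push φ Q) R h) (e : g ≫ f = h), motive α → motive (pullR f α e))
    (hmain : ∀ {B : C} {R : Frm p B} {g : A ⟶ B} {h : Z ⟶ B} (α : Deriv Q R h)
      (e : φ ≫ g = h), motive (pushL φ α e)) :
    ∀ {B : C} {R : Frm p B} {g : A ⟶ B} (α : Deriv (.push φ Q) R g), motive α
  | _, _, _, .pushR f α e => hpushR α e (ind_source_push hpushR hpullR hmain α)
  | _, _, _, .pullR f α e => hpullR α e (ind_source_push hpushR hpullR hmain α)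
  | _, _, _, .pushL _ α e => hmain α e

theorem ind_source_pull {A Z : C} {φ : A ⟶ Z} {Q : Frm p Z}
    {motive : ∀ {B : C} {R : Frm p B} {g : A ⟶ B}, Deriv (.pull φ Q) R g → Prop}
    (hpushR : ∀ {B E : C} {R : Frm p B} {f : B ⟶ E} {g : A ⟶ B} {h : A ⟶ E}
      (α : Deriv (.pull φ Q) R g) (e : g ≫ f = h), motive α → motive (pushR f α e))
    (hpullR : ∀ {B E : C} {R : Frm p E} {f : B ⟶ E} {g : A ⟶ B} {h : A ⟶ E}
      (α : Deriv (.pull φ Q) R h) (e : g ≫ f = h), motive α → motive (pullR f α e))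
    (hmain : ∀ {B : C} {R : Frm p B} {g : Z ⟶ B} {h : A ⟶ B} (α : Deriv Q R g)
      (e : φ ≫ g = h), motive (pullL φ α e)) :
    ∀ {B : C} {R : Frm p B} {g : A ⟶ B} (α : Deriv (.pull φ Q) R g), motive α
  | _, _, _, .pushR f α e => hpushR α e (ind_source_pull hpushR hpullR hmain α)
  | _, _, _, .pullR f α e => hpullR α e (ind_source_pull hpushR hpullR hmain α)
  | _, _, _, .pullL _ α e => hmain α e

theorem ind_source_atom {A : C} {X : D} {hX : p.obj X = A}
    {motive : ∀ {B : C} {R : Frm p B} {g : A ⟶ B}, Deriv (.atom X hX) R g → Prop}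
    (hpushR : ∀ {B E : C} {R : Frm p B} {f : B ⟶ E} {g : A ⟶ B} {h : A ⟶ E}
      (α : Deriv (.atom X hX) R g) (e : g ≫ f = h), motive α → motive (pushR f α e))
    (hpullR : ∀ {B E : C} {R : Frm p E} {f : B ⟶ E} {g : A ⟶ B} {h : A ⟶ E}
      (α : Deriv (.atom X hX) R h) (e : g ≫ f = h), motive α → motive (pullR f α e))
    (hmain : ∀ {B : C} {Y : D} {hY : p.obj Y = B} {g : A ⟶ B} (δ : X ⟶ Y)
      (hδ : p.IsHomLift g δ), motive (Deriv.ax (hX := hX) (hY := hY) δ hδ)) :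
    ∀ {B : C} {R : Frm p B} {g : A ⟶ B} (α : Deriv (.atom X hX) R g), motive α
  | _, _, _, .pushR f α e => hpushR α e (ind_source_atom hpushR hpullR hmain α)
  | _, _, _, .pullR f α e => hpullR α e (ind_source_atom hpushR hpullR hmain α)
  | _, _, _, .ax δ hδ => hmain δ hδ

theorem cut_congr_right {S : Frm p A} {T : Frm p B} {U : Frm p E} {g : A ⟶ B} {h : B ⟶ E}
    {k : A ⟶ E} (α : Deriv S T g) {β β' : Deriv T U h} (H : PermEq β β') (w : g ≫ h = k) :
    PermEq (cut α β w) (cut α β' w) := by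
  induction H generalizing A with
  | refl β => exact .refl _
  | symm _ ih => exact .symm (ih α w)
  | trans _ _ ih₁ ih₂ => exact .trans (ih₁ α w) (ih₂ α w)
  | congr_pushR e _ ih =>
      refine .trans (cut_pushR _ _ e w rfl (by simp [← w, ← e])) ?_
      refine .trans (.congr_pushR _ (ih α rfl)) ?_
      exact .symm (cut_pushR _ _ _ _ _ _)
  | congr_pullR e _ ih =>
      refine .trans (cut_pullR _ _ e w rfl (by simp [← w, ← e])) ?_
      refine .trans (.congr_pullR _ (ih α rfl)) ?_
      exact .symm (cut_pullR _ _ _ _ _ _)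
  | congr_pushL e _ ih =>
      revert k
      refine ind_target_push (motive := fun {_ _ g} α => ∀ {k} (w : g ≫ _ = k),
        PermEq (cut α _ w) (cut α _ w)) ?_ ?_ ?_ α
      · intro _ _ _ _ _ _ α e ih' k w
        rw [cut, cut]; exact .congr_pushL _ (ih' rfl)
      · intro _ _ _ _ _ _ α e ih' k w
        rw [cut, cut]; exact .congr_pullL _ (ih' rfl)
      · intro _ _ _ _ α e k w
        rw [cut, cut]; exact ih α _
  | congr_pullL e _ ih =>
      revert k
      refine ind_target_pull (motive := fun {_ _ g} α => ∀ {k} (w : g ≫ _ = k),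
        PermEq (cut α _ w) (cut α _ w)) ?_ ?_ ?_ α
      · intro _ _ _ _ _ _ α e ih' k w
        rw [cut, cut]; exact .congr_pushL _ (ih' rfl)
      · intro _ _ _ _ _ _ α e ih' k w
        rw [cut, cut]; exact .congr_pullL _ (ih' rfl)
      · intro _ _ _ _ α e k w
        rw [cut, cut]; exact ih α _
  | pullL_pushR β e₁ e₂ e₃ e₄ =>
      revert k
      refine ind_target_pull (motive := fun {_ _ g} α => ∀ {k} (w : g ≫ _ = k),
        PermEq (cut α _ w) (cut α _ w)) ?_ ?_ ?_ α
      · intro _ _ _ _ _ _ α e ih' k w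
        rw [cut, cut]; exact .congr_pushL _ (ih' rfl)
      · intro _ _ _ _ _ _ α e ih' k w
        rw [cut, cut]; exact .congr_pullL _ (ih' rfl)
      · intro _ _ _ _ α e k w
        refine .trans (cut_pushR _ _ _ _ rfl (by simp [← w, ← e₁, ← e₂, ← e₃, ← e₄])) ?_
        rw [cut, cut]
        exact .symm (cut_pushR _ _ _ _ _ _)
  | pushL_pushR β e₁ e₂ e₃ e₄ =>
      revert k
      refine ind_target_push (motive := fun {_ _ g} α => ∀ {k} (w : g ≫ _ = k),
        PermEq (cut α _ w) (cut α _ w)) ?_ ?_ ?_ α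
      · intro _ _ _ _ _ _ α e ih' k w
        rw [cut, cut]; exact .congr_pushL _ (ih' rfl)
      · intro _ _ _ _ _ _ α e ih' k w
        rw [cut, cut]; exact .congr_pullL _ (ih' rfl)
      · intro _ _ _ _ α e k w
        refine .trans (cut_pushR _ _ _ _ rfl (by simp [← w, ← e₁, ← e₂, ← e₃, ← e₄])) ?_
        rw [cut, cut]
        exact .symm (cut_pushR _ _ _ _ _ _)
  | pullL_pullR β e₁ e₂ e₃ e₄ =>
      revert k
      refine ind_target_pull (motive := fun {_ _ g} α => ∀ {k} (w : g ≫ _ = k),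
        PermEq (cut α _ w) (cut α _ w)) ?_ ?_ ?_ α
      · intro _ _ _ _ _ _ α e ih' k w
        rw [cut, cut]; exact .congr_pushL _ (ih' rfl)
      · intro _ _ _ _ _ _ α e ih' k w
        rw [cut, cut]; exact .congr_pullL _ (ih' rfl)
      · intro _ _ _ _ α e k w
        refine .trans (cut_pullR _ _ _ _ rfl (by simp [← w, ← e₁, ← e₂, ← e₃, ← e₄])) ?_
        rw [cut, cut]
        exact .symm (cut_pullR _ _ _ _ _ _)
  | pushL_pullR β e₁ e₂ e₃ e₄ =>
      revert k
      refine ind_target_push (motive := fun {_ _ g} α => ∀ {k} (w : g ≫ _ = k),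
        PermEq (cut α _ w) (cut α _ w)) ?_ ?_ ?_ α
      · intro _ _ _ _ _ _ α e ih' k w
        rw [cut, cut]; exact .congr_pushL _ (ih' rfl)
      · intro _ _ _ _ _ _ α e ih' k w
        rw [cut, cut]; exact .congr_pullL _ (ih' rfl)
      · intro _ _ _ _ α e k w
        refine .trans (cut_pullR _ _ _ _ rfl (by simp [← w, ← e₁, ← e₂, ← e₃, ← e₄])) ?_
        rw [cut, cut]
        exact .symm (cut_pullR _ _ _ _ _ _)

theorem cut_congr_left {S : Frm p A} {T : Frm p B} {U : Frm p E} {g : A ⟶ B} {h : B ⟶ E}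
    {k : A ⟶ E} {α α' : Deriv S T g} (H : PermEq α α') (β : Deriv T U h) (w : g ≫ h = k) :
    PermEq (cut α β w) (cut α' β w) := by
  induction H generalizing E with
  | refl β => exact .refl _
  | symm _ ih => exact .symm (ih β w)
  | trans _ _ ih₁ ih₂ => exact .trans (ih₁ β w) (ih₂ β w)
  | congr_pushL e _ ih => rw [cut, cut]; exact .congr_pushL _ (ih β rfl)
  | congr_pullL e _ ih => rw [cut, cut]; exact .congr_pullL _ (ih β rfl)
  | congr_pushR e _ ih =>
      revert k
      refine ind_source_push (motive := fun {_ _ h} β => ∀ {k} (w : _ ≫ h = k),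
        PermEq (cut _ β w) (cut _ β w)) ?_ ?_ ?_ β
      · intro _ _ _ _ _ _ β e ih' k w
        refine .trans (cut_pushR _ _ e w rfl (by simp [← w, ← e])) ?_
        refine .trans (.congr_pushR _ (ih' rfl)) ?_
        exact .symm (cut_pushR _ _ _ _ _ _)
      · intro _ _ _ _ _ _ β e ih' k w
        refine .trans (cut_pullR _ _ e w rfl (by simp [← w, ← e])) ?_
        refine .trans (.congr_pullR _ (ih' rfl)) ?_
        exact .symm (cut_pullR _ _ _ _ _ _)
      · intro _ _ _ _ β e k w
        rw [cut, cut]; exact ih β _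
  | congr_pullR e _ ih =>
      revert k
      refine ind_source_pull (motive := fun {_ _ h} β => ∀ {k} (w : _ ≫ h = k),
        PermEq (cut _ β w) (cut _ β w)) ?_ ?_ ?_ β
      · intro _ _ _ _ _ _ β e ih' k w
        refine .trans (cut_pushR _ _ e w rfl (by simp [← w, ← e])) ?_
        refine .trans (.congr_pushR _ (ih' rfl)) ?_
        exact .symm (cut_pushR _ _ _ _ _ _)
      · intro _ _ _ _ _ _ β e ih' k w
        refine .trans (cut_pullR _ _ e w rfl (by simp [← w, ← e])) ?_
        refine .trans (.congr_pullR _ (ih' rfl)) ?_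
        exact .symm (cut_pullR _ _ _ _ _ _)
      · intro _ _ _ _ β e k w
        rw [cut, cut]; exact ih β _
  | pullL_pushR α e₁ e₂ e₃ e₄ =>
      revert k
      refine ind_source_push (motive := fun {_ _ h} β => ∀ {k} (w : _ ≫ h = k),
        PermEq (cut _ β w) (cut _ β w)) ?_ ?_ ?_ β
      · intro _ _ _ _ _ _ β e ih' k w
        refine .trans (cut_pushR _ _ e w rfl (by simp [← w, ← e])) ?_
        refine .trans (.congr_pushR _ (ih' rfl)) ?_
        exact .symm (cut_pushR _ _ _ _ _ _)
      · intro _ _ _ _ _ _ β e ih' k w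
        refine .trans (cut_pullR _ _ e w rfl (by simp [← w, ← e])) ?_
        refine .trans (.congr_pullR _ (ih' rfl)) ?_
        exact .symm (cut_pullR _ _ _ _ _ _)
      · intro _ _ _ _ β e k w
        rw [cut, cut, cut, cut]; exact pullL_cut_refl _ _ _ _ _ _
  | pushL_pushR α e₁ e₂ e₃ e₄ =>
      revert k
      refine ind_source_push (motive := fun {_ _ h} β => ∀ {k} (w : _ ≫ h = k),
        PermEq (cut _ β w) (cut _ β w)) ?_ ?_ ?_ β
      · intro _ _ _ _ _ _ β e ih' k w
        refine .trans (cut_pushR _ _ e w rfl (by simp [← w, ← e])) ?_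
        refine .trans (.congr_pushR _ (ih' rfl)) ?_
        exact .symm (cut_pushR _ _ _ _ _ _)
      · intro _ _ _ _ _ _ β e ih' k w
        refine .trans (cut_pullR _ _ e w rfl (by simp [← w, ← e])) ?_
        refine .trans (.congr_pullR _ (ih' rfl)) ?_
        exact .symm (cut_pullR _ _ _ _ _ _)
      · intro _ _ _ _ β e k w
        rw [cut, cut, cut, cut]; exact pushL_cut_refl _ _ _ _ _ _
  | pullL_pullR α e₁ e₂ e₃ e₄ =>
      revert k
      refine ind_source_pull (motive := fun {_ _ h} β => ∀ {k} (w : _ ≫ h = k),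
        PermEq (cut _ β w) (cut _ β w)) ?_ ?_ ?_ β
      · intro _ _ _ _ _ _ β e ih' k w
        refine .trans (cut_pushR _ _ e w rfl (by simp [← w, ← e])) ?_
        refine .trans (.congr_pushR _ (ih' rfl)) ?_
        exact .symm (cut_pushR _ _ _ _ _ _)
      · intro _ _ _ _ _ _ β e ih' k w
        refine .trans (cut_pullR _ _ e w rfl (by simp [← w, ← e])) ?_
        refine .trans (.congr_pullR _ (ih' rfl)) ?_
        exact .symm (cut_pullR _ _ _ _ _ _)
      · intro _ _ _ _ β e k w
        rw [cut, cut, cut, cut]; exact pullL_cut_refl _ _ _ _ _ _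
  | pushL_pullR α e₁ e₂ e₃ e₄ =>
      revert k
      refine ind_source_pull (motive := fun {_ _ h} β => ∀ {k} (w : _ ≫ h = k),
        PermEq (cut _ β w) (cut _ β w)) ?_ ?_ ?_ β
      · intro _ _ _ _ _ _ β e ih' k w
        refine .trans (cut_pushR _ _ e w rfl (by simp [← w, ← e])) ?_
        refine .trans (.congr_pushR _ (ih' rfl)) ?_
        exact .symm (cut_pushR _ _ _ _ _ _)
      · intro _ _ _ _ _ _ β e ih' k w
        refine .trans (cut_pullR _ _ e w rfl (by simp [← w, ← e])) ?_
        refine .trans (.congr_pullR _ (ih' rfl)) ?_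
        exact .symm (cut_pullR _ _ _ _ _ _)
      · intro _ _ _ _ β e k w
        rw [cut, cut, cut, cut]; exact pushL_cut_refl _ _ _ _ _ _

theorem id_cut : {A B : C} → (S : Frm p A) → {T : Frm p B} → {g : A ⟶ B} →
    (α : Deriv S T g) → (w : 𝟙 A ≫ g = g) → PermEq (cut (idDeriv S) α w) α := by
  intro A B S
  induction S generalizing B with
  | atom X hX =>
      intro T g α
      refine ind_source_atom (motive := fun {B T g} α => ∀ (w : 𝟙 _ ≫ g = g),
        PermEq (cut (idDeriv (.atom X hX)) α w) α) ?_ ?_ ?_ α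
      · intro _ _ _ _ _ _ α e ih w
        exact .trans (cut_pushR _ _ e w (by simp) e) (.congr_pushR _ (ih _))
      · intro _ _ _ _ _ _ α e ih w
        exact .trans (cut_pullR _ _ e w (by simp) e) (.congr_pullR _ (ih _))
      · intro _ _ _ _ δ hδ w
        rw [idDeriv, cut]
        simp only [Category.id_comp]
        exact .refl _
  | push f S ihS =>
      intro T g α
      refine ind_source_push (motive := fun {B T g} α => ∀ (w : 𝟙 _ ≫ g = g),
        PermEq (cut (idDeriv (.push f S)) α w) α) ?_ ?_ ?_ α
      · intro _ _ _ _ _ _ α e ih w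
        exact .trans (cut_pushR _ _ e w (by simp) e) (.congr_pushR _ (ih _))
      · intro _ _ _ _ _ _ α e ih w
        exact .trans (cut_pullR _ _ e w (by simp) e) (.congr_pullR _ (ih _))
      · intro _ _ _ _ α e w
        rw [idDeriv, cut_pushL _ _ _ _ e e, cut]
        exact .congr_pushL _ (ihS α _)
  | pull f S ihS =>
      intro T g α
      refine ind_source_pull (motive := fun {B T g} α => ∀ (w : 𝟙 _ ≫ g = g),
        PermEq (cut (idDeriv (.pull f S)) α w) α) ?_ ?_ ?_ α
      · intro _ _ _ _ _ _ α e ih w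
        exact .trans (cut_pushR _ _ e w (by simp) e) (.congr_pushR _ (ih _))
      · intro _ _ _ _ _ _ α e ih w
        exact .trans (cut_pullR _ _ e w (by simp) e) (.congr_pullR _ (ih _))
      · intro _ _ _ _ α e w
        rw [idDeriv, cut, cut_pullL _ _ _ _ (Category.id_comp _) e]
        exact .congr_pullL _ (ihS α _)

theorem cut_id : {A B : C} → {S : Frm p A} → (T : Frm p B) → {g : A ⟶ B} →
    (α : Deriv S T g) → (w : g ≫ 𝟙 B = g) → PermEq (cut α (idDeriv T) w) α := by
  intro A B S T
  induction T generalizing A with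
  | atom X hX =>
      intro g α
      refine ind_target_atom (motive := fun {A S g} α => ∀ (w : g ≫ 𝟙 _ = g),
        PermEq (cut α (idDeriv (.atom X hX)) w) α) ?_ ?_ ?_ α
      · intro _ _ _ _ _ _ α e ih w
        rw [cut_pushL _ _ _ _ (Category.comp_id _) e]
        exact .congr_pushL _ (ih _)
      · intro _ _ _ _ _ _ α e ih w
        rw [cut_pullL _ _ _ _ (Category.comp_id _) e]
        exact .congr_pullL _ (ih _)
      · intro _ _ _ _ δ hδ w
        rw [idDeriv, cut]
        simp only [Category.comp_id]
        exact .refl _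
  | push f T ihT =>
      intro g α
      refine ind_target_push (motive := fun {A S g} α => ∀ (w : g ≫ 𝟙 _ = g),
        PermEq (cut α (idDeriv (.push f T)) w) α) ?_ ?_ ?_ α
      · intro _ _ _ _ _ _ α e ih w
        rw [cut_pushL _ _ _ _ (Category.comp_id _) e]
        exact .congr_pushL _ (ih _)
      · intro _ _ _ _ _ _ α e ih w
        rw [cut_pullL _ _ _ _ (Category.comp_id _) e]
        exact .congr_pullL _ (ih _)
      · intro _ _ _ _ α e w
        rw [idDeriv, cut]
        exact .trans (cut_pushR _ _ _ _ (Category.comp_id _) e) (.congr_pushR _ (ihT α _))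
  | pull f T ihT =>
      intro g α
      refine ind_target_pull (motive := fun {A S g} α => ∀ (w : g ≫ 𝟙 _ = g),
        PermEq (cut α (idDeriv (.pull f T)) w) α) ?_ ?_ ?_ α
      · intro _ _ _ _ _ _ α e ih w
        rw [cut_pushL _ _ _ _ (Category.comp_id _) e]
        exact .congr_pushL _ (ih _)
      · intro _ _ _ _ _ _ α e ih w
        rw [cut_pullL _ _ _ _ (Category.comp_id _) e]
        exact .congr_pullL _ (ih _)
      · intro _ _ _ _ α e w
        rw [idDeriv]
        refine .trans (cut_pullR _ _ _ _ e e) (.congr_pullR _ ?_)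
        rw [cut]
        exact ihT α _

theorem cut_assoc {A B E F : C} {S : Frm p A} {T : Frm p B} {U : Frm p E} {V : Frm p F}
    {f : A ⟶ B} {g : B ⟶ E} {h : E ⟶ F} {fg : A ⟶ E} {gh : B ⟶ F} {k : A ⟶ F}
    (α : Deriv S T f) (β : Deriv T U g) (γ : Deriv U V h) (w₁ : f ≫ g = fg) (w₂ : fg ≫ h = k)
    (w₃ : g ≫ h = gh) (w₄ : f ≫ gh = k) :
    PermEq (cut (cut α β w₁) γ w₂) (cut α (cut β γ w₃) w₄) := by
  induction β generalizing A F with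
  | pushL q β e ih =>
      revert fg k
      refine ind_target_push (motive := fun {A S f} α => ∀ {fg k}
        (w₁ : f ≫ _ = fg) (w₂ : fg ≫ h = k) (w₄ : f ≫ gh = k),
        PermEq (cut (cut α _ w₁) γ w₂) (cut α (cut _ γ w₃) w₄)) ?_ ?_ ?_ α
      · intro _ _ _ _ _ _ α e ih' fg k w₁ w₂ w₄
        rw [cut, cut, cut]
        refine .trans ?_ (.congr_pushL _ (ih' rfl (by simp [← w₃]) rfl))
        exact pushL_cut_refl _ _ _ _ _ _
      · intro _ _ _ _ _ _ α e ih' fg k w₁ w₂ w₄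
        rw [cut, cut, cut]
        refine .trans ?_ (.congr_pullL _ (ih' rfl (by simp [← w₃]) rfl))
        exact pullL_cut_refl _ _ _ _ _ _
      · intro _ _ _ _ α e' fg k w₁ w₂ w₄
        rw [cut_pushL _ e γ w₃ rfl (by simp [← w₃, ← e]), cut, cut]
        exact ih α γ _ _ _ _
  | pullL q β e ih =>
      revert fg k
      refine ind_target_pull (motive := fun {A S f} α => ∀ {fg k}
        (w₁ : f ≫ _ = fg) (w₂ : fg ≫ h = k) (w₄ : f ≫ gh = k),
        PermEq (cut (cut α _ w₁) γ w₂) (cut α (cut _ γ w₃) w₄)) ?_ ?_ ?_ α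
      · intro _ _ _ _ _ _ α e' ih' fg k w₁ w₂ w₄
        rw [cut_pushL α e' _ w₁ rfl (by simp [← w₁, ← e']),
          cut_pushL _ _ γ w₂ rfl (by simp [← w₂, ← w₁, ← e']),
          cut_pushL α e' _ w₄ rfl (by simp [← w₄, ← e'])]
        refine .trans ?_ (.congr_pushL _ (ih' rfl (by simp [← w₃]) rfl))
        exact pushL_cut_refl _ _ _ _ _ _
      · intro _ _ _ _ _ _ α e ih' fg k w₁ w₂ w₄
        rw [cut, cut, cut]
        refine .trans ?_ (.congr_pullL _ (ih' rfl (by simp [← w₃]) rfl))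
        exact pullL_cut_refl _ _ _ _ _ _
      · intro _ _ _ _ α e' fg k w₁ w₂ w₄
        rw [cut_pullL _ e γ w₃ rfl (by simp [← w₃, ← e]), cut, cut]
        exact ih α γ _ _ _ _
  | pushR q β e ih =>
      revert gh k
      refine ind_source_push (motive := fun {F V h} γ => ∀ {gh k}
        (w₂ : fg ≫ h = k) (w₃ : _ ≫ h = gh) (w₄ : f ≫ gh = k),
        PermEq (cut (cut α _ w₁) γ w₂) (cut α (cut _ γ w₃) w₄)) ?_ ?_ ?_ γ
      · intro _ _ _ _ _ _ γ e ih' gh k w₂ w₃ w₄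
        refine .trans (cut_pushR _ _ e w₂ rfl (by simp [← w₂, ← e])) ?_
        refine .trans (.congr_pushR _ (ih' rfl rfl (by simp [← w₁]))) ?_
        refine .trans ?_ (cut_congr_right _ (.symm (cut_pushR _ _ e w₃ rfl (by simp [← w₃, ← e]))) _)
        exact .symm (cut_pushR _ _ _ _ _ _)
      · intro _ _ _ _ _ _ γ e ih' gh k w₂ w₃ w₄
        refine .trans (cut_pullR _ _ e w₂ rfl (by simp [← w₂, ← e])) ?_
        refine .trans (.congr_pullR _ (ih' rfl rfl (by simp [← w₁]))) ?_
        refine .trans ?_ (cut_congr_right _ (.symm (cut_pullR _ _ e w₃ rfl (by simp [← w₃, ← e]))) _)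
        exact .symm (cut_pullR _ _ _ _ _ _)
      · intro _ _ _ _ γ e' gh k w₂ w₃ w₄
        refine .trans (cut_congr_left (cut_pushR _ _ e w₁ rfl (by simp [← w₁, ← e])) _ _) ?_
        rw [cut, cut]
        exact ih α γ _ _ _ _
  | pullR q β e ih =>
      revert gh k
      refine ind_source_pull (motive := fun {F V h} γ => ∀ {gh k}
        (w₂ : fg ≫ h = k) (w₃ : _ ≫ h = gh) (w₄ : f ≫ gh = k),
        PermEq (cut (cut α _ w₁) γ w₂) (cut α (cut _ γ w₃) w₄)) ?_ ?_ ?_ γ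
      · intro _ _ _ _ _ _ γ e ih' gh k w₂ w₃ w₄
        refine .trans (cut_pushR _ _ e w₂ rfl (by simp [← w₂, ← e])) ?_
        refine .trans (.congr_pushR _ (ih' rfl rfl (by simp [← w₁]))) ?_
        refine .trans ?_ (cut_congr_right _ (.symm (cut_pushR _ _ e w₃ rfl (by simp [← w₃, ← e]))) _)
        exact .symm (cut_pushR _ _ _ _ _ _)
      · intro _ _ _ _ _ _ γ e ih' gh k w₂ w₃ w₄
        refine .trans (cut_pullR _ _ e w₂ rfl (by simp [← w₂, ← e])) ?_
        refine .trans (.congr_pullR _ (ih' rfl rfl (by simp [← w₁]))) ?_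
        refine .trans ?_ (cut_congr_right _ (.symm (cut_pullR _ _ e w₃ rfl (by simp [← w₃, ← e]))) _)
        exact .symm (cut_pullR _ _ _ _ _ _)
      · intro _ _ _ _ γ e' gh k w₂ w₃ w₄
        refine .trans (cut_congr_left (cut_pullR _ _ e w₁ rfl (by simp [← w₁, ← e])) _ _) ?_
        rw [cut, cut]
        exact ih α γ _ _ _ _
  | ax δ hδ =>
      revert fg k
      refine ind_target_atom (motive := fun {A S f} α => ∀ {fg k}
        (w₁ : f ≫ _ = fg) (w₂ : fg ≫ h = k) (w₄ : f ≫ gh = k),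
        PermEq (cut (cut α _ w₁) γ w₂) (cut α (cut _ γ w₃) w₄)) ?_ ?_ ?_ α
      · intro _ _ _ _ _ _ α e ih' fg k w₁ w₂ w₄
        rw [cut, cut, cut]
        refine .trans ?_ (.congr_pushL _ (ih' rfl (by simp [← w₃]) rfl))
        exact pushL_cut_refl _ _ _ _ _ _
      · intro _ _ _ _ _ _ α e ih' fg k w₁ w₂ w₄
        rw [cut, cut, cut]
        refine .trans ?_ (.congr_pullL _ (ih' rfl (by simp [← w₃]) rfl))
        exact pullL_cut_refl _ _ _ _ _ _
      · intro _ _ _ f δ' hδ' fg k w₁ w₂ w₄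
        revert gh k
        refine ind_source_atom (motive := fun {F V h} γ => ∀ {gh}
          (w₃ : _ ≫ h = gh) {k} (w₂ : fg ≫ h = k) (w₄ : f ≫ gh = k),
          PermEq (cut (cut (Deriv.ax δ' hδ') (Deriv.ax δ hδ) w₁) γ w₂)
            (cut (Deriv.ax δ' hδ') (cut (Deriv.ax δ hδ) γ w₃) w₄)) ?_ ?_ ?_ γ
        · intro _ _ _ _ _ _ γ e ih' gh w₃ k w₂ w₄
          refine .trans (cut_pushR _ _ e w₂ rfl (by simp [← w₂, ← e])) ?_
          refine .trans (.congr_pushR _ (ih' rfl rfl (by simp [← w₁]))) ?_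
          refine .trans ?_ (cut_congr_right _ (.symm (cut_pushR _ _ e w₃ rfl (by simp [← w₃, ← e]))) _)
          exact .symm (cut_pushR _ _ _ _ _ _)
        · intro _ _ _ _ _ _ γ e ih' gh w₃ k w₂ w₄
          refine .trans (cut_pullR _ _ e w₂ rfl (by simp [← w₂, ← e])) ?_
          refine .trans (.congr_pullR _ (ih' rfl rfl (by simp [← w₁]))) ?_
          refine .trans ?_ (cut_congr_right _ (.symm (cut_pullR _ _ e w₃ rfl (by simp [← w₃, ← e]))) _)
          exact .symm (cut_pullR _ _ _ _ _ _)
        · intro _ _ _ _ ε hε gh w₃ k w₂ w₄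
          rw [cut, cut, cut, cut]
          simp only [Category.assoc]
          exact .refl _

end CutLemmas

/-! ### The category `Bif p` and its projection to the base -/

/-- Objects of `Bif p`: formulas together with the base object they lie over. -/
structure Bif (p : D ⥤ C) where
  base : C
  frm : Frm p base

/-- Arrows of `Bif p`: a base arrow `h` and a permutation class of derivations over `h`. -/
@[ext]
structure Bif.Hom (S T : Bif p) where
  base : S.base ⟶ T.base
  cls : Quotient (permSetoid S.frm T.frm base)

theorem Bif.Hom.mk_cut {S T U : Bif p} {g : S.base ⟶ T.base} {h : T.base ⟶ U.base}
    {k : S.base ⟶ U.base} (α : Deriv S.frm T.frm g) (β : Deriv T.frm U.frm h) (w : g ≫ h = k) :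
    (⟨g ≫ h, Quotient.mk _ (cut α β rfl)⟩ : Bif.Hom S U) = ⟨k, Quotient.mk _ (cut α β w)⟩ := by
  subst w; rfl

/-- Identities are identity derivations and composition is cut. -/
instance : Category (Bif p) where
  Hom S T := Bif.Hom S T
  id S := ⟨𝟙 S.base, Quotient.mk _ (idDeriv S.frm)⟩
  comp {_ _ _} α β := ⟨α.base ≫ β.base,
    Quotient.liftOn₂ α.cls β.cls (fun a b => Quotient.mk _ (cut a b rfl))
      (fun _ b a' _ ha hb => Quotient.sound
        (.trans (cut_congr_left ha b rfl) (cut_congr_right a' hb rfl)))⟩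
  id_comp := by
    rintro S T ⟨f, ⟨α⟩⟩
    exact (Bif.Hom.mk_cut _ _ (Category.id_comp f)).trans
      (congrArg (Bif.Hom.mk f) (Quotient.sound (id_cut _ α _)))
  comp_id := by
    rintro S T ⟨f, ⟨α⟩⟩
    exact (Bif.Hom.mk_cut _ _ (Category.comp_id f)).trans
      (congrArg (Bif.Hom.mk f) (Quotient.sound (cut_id _ α _)))
  assoc := by
    rintro S T U V ⟨f, ⟨α⟩⟩ ⟨g, ⟨β⟩⟩ ⟨h, ⟨γ⟩⟩
    refine (Bif.Hom.mk_cut _ _ (Category.assoc f g h)).trans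
      (congrArg (Bif.Hom.mk _) (Quotient.sound (cut_assoc α β γ rfl _ rfl rfl)))

/-- The projection `Bif p ⥤ C`, the free bifibration on `p`. -/
def Bif.proj (p : D ⥤ C) : Bif p ⥤ C where
  obj S := S.base
  map α := α.base

/-! ### Pushing and pulling along sequences of arrows

A composable sequence `π = (f₀, …, fₙ)` is a `Quiver.Path` in `C`, with composite
`composePath π`.  `pushSeq π S` is `push fₙ (… (push f₀ S))` and `pullSeq π T` is
`pull f₀ (… (pull fₙ T))`. -/

def pushSeq {A : C} : {B : C} → Quiver.Path A B → Frm p A → Frm p B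
  | _, .nil, S => S
  | _, .cons π f, S => .push f (pushSeq π S)

def pullSeq {A : C} : {B : C} → Quiver.Path A B → Frm p B → Frm p A
  | _, .nil, T => T
  | _, .cons π f, T => pullSeq π (.pull f T)

/-- Non-positive formulas `N`: atoms and pull formulas. -/
def Frm.NonPos {A : C} : Frm p A → Prop
  | .push _ _ => False
  | _ => True

/-- Non-negative formulas `P`: atoms and push formulas. -/
def Frm.NonNeg {A : C} : Frm p A → Prop
  | .pull _ _ => False
  | _ => True

/-- Iterated left division. -/
def pushLs {A E : C} {S : Frm p A} {T : Frm p E} : {B : C} → (π : Quiver.Path A B) →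
    {g : B ⟶ E} → {h : A ⟶ E} → Deriv S T h → composePath π ≫ g = h → Deriv (pushSeq π S) T g
  | _, .nil, _, _, α, e => (e.symm.trans (Category.id_comp _)) ▸ α
  | _, .cons π f, g, _, α, e => .pushL f (pushLs π (g := f ≫ g) α (by simpa using e)) rfl

/-- Iterated right multiplication. -/
def pushRs {A B : C} {S : Frm p A} {T : Frm p B} : {E : C} → (π : Quiver.Path B E) →
    {g : A ⟶ B} → {h : A ⟶ E} → Deriv S T g → g ≫ composePath π = h → Deriv S (pushSeq π T) h
  | _, .nil, _, _, α, e => ((Category.comp_id _).symm.trans e) ▸ α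
  | _, .cons π f, _, _, α, e => .pushR f (pushRs π α rfl) (by simpa using e)

/-- Iterated left multiplication. -/
def pullLs {A E : C} {T : Frm p E} : {B : C} → {S : Frm p B} → (π : Quiver.Path A B) →
    {g : B ⟶ E} → {h : A ⟶ E} → Deriv S T g → composePath π ≫ g = h → Deriv (pullSeq π S) T h
  | _, _, .nil, _, _, α, e => ((Category.id_comp _).symm.trans e) ▸ α
  | _, _, .cons π f, _, _, α, e => pullLs π (.pullL f α rfl) (by simpa using e)

/-- Iterated right division. -/
def pullRs {A B : C} {S : Frm p A} : {E : C} → {T : Frm p E} → (π : Quiver.Path B E) →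
    {g : A ⟶ B} → {h : A ⟶ E} → Deriv S T h → g ≫ composePath π = h → Deriv S (pullSeq π T) g
  | _, _, .nil, _, _, α, e => (e.symm.trans (Category.comp_id _)) ▸ α
  | _, _, .cons π f, g, _, α, e =>
      pullRs π (.pullR (g := g ≫ composePath π) f α (by simpa using e)) rfl

/-! ### Maximally multifocused proofs -/

/-- The factorization order: `(a, b) ≤ (c, d)` iff there is `e` with `c = a e` and `b = e d`. -/
def FactLE {A B X Y : C} (a : A ⟶ X) (b : X ⟶ B) (c : A ⟶ Y) (d : Y ⟶ B) : Prop :=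
  ∃ e : X ⟶ Y, c = a ≫ e ∧ b = e ≫ d

/-- Pre-inversion states `·`, `L`, `R`. -/
inductive PreInv
  | unlocked | left | right

/-- Pre-focus states `⊥`, `L[π, f]`, `R[f, ρ]` for a sequent over an arrow `A ⟶ B`.  Only the
composites of the sequences `π` and `ρ` matter and are recorded. -/
inductive PreFocus (A B : C) : Type (max u₁ v₁)
  | bot
  | left {X : C} (π : A ⟶ X) (f : X ⟶ B)
  | right {X : C} (f : A ⟶ X) (ρ : X ⟶ B)

inductive State (A B : C) : Type (max u₁ v₁)
  | inv (q : PreInv)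
  | foc (q : PreFocus A B)

/-- Side condition for left-focusing on `σ` with premise over `g`. -/
def PreFocus.AllowsL {A B X : C} (q : PreFocus A B) (σ : A ⟶ X) (g : X ⟶ B) : Prop :=
  match q with
  | .right f ρ => ¬ FactLE σ g f ρ
  | _ => True

/-- Side condition for right-focusing on `τ` with premise over `g`. -/
def PreFocus.AllowsR {A B Y : C} (q : PreFocus A B) (g : A ⟶ Y) (τ : Y ⟶ B) : Prop :=
  match q with
  | .left π f => ¬ FactLE π f g τ
  | _ => True

/-- Side condition for bi-focusing on `σ` and `τ` with premise over `g`. -/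
def PreFocus.AllowsLR {A B X Y : C} (q : PreFocus A B) (σ : A ⟶ X) (g : X ⟶ Y) (τ : Y ⟶ B) :
    Prop :=
  match q with
  | .left π f => ¬ FactLE π f (σ ≫ g) τ
  | .right f ρ => ¬ FactLE σ (g ≫ τ) f ρ
  | .bot => True

/-- `MaxMult q S T f` is the type of maximally multifocused proofs of `S ⊢_f T` in state `q`.

In the inversion rules the sequences `π`, `ρ` may be empty.  As `N` is non-positive and `P`
non-negative, `π` (resp. `ρ`) is empty exactly if the left (resp. right) side of the conclusion is
not a push (resp. pull) formula, so exactly one inversion step applies to a sequent in a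
pre-inversion state.  In the unlocked state the one-sided inversions, the bi-inversion and the
trivial step on a neutral sequent all lead to the state `⊥`, and `inv` comprises them all. -/
inductive MaxMult : {A B : C} → State A B → Frm p A → Frm p B → (A ⟶ B) →
    Type (max u₁ v₁ u₂ v₂)
  | ax {A B : C} (q : PreFocus A B) {X Y : D} {hX : p.obj X = A} {hY : p.obj Y = B} {f : A ⟶ B}
      (δ : X ⟶ Y) (hδ : p.IsHomLift f δ) : MaxMult (.foc q) (.atom X hX) (.atom Y hY) f
  | inv {A B A' B' : C} (π : Quiver.Path A' A) (ρ : Quiver.Path B B')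
      {N : Frm p A'} {P : Frm p B'} {S : Frm p A} {T : Frm p B} {f : A ⟶ B} {h : A' ⟶ B'}
      (hN : N.NonPos) (hP : P.NonNeg) (hS : pushSeq π N = S) (hT : pullSeq ρ P = T)
      (e : composePath π ≫ f ≫ composePath ρ = h)
      (m : MaxMult (.foc .bot) N P h) : MaxMult (.inv .unlocked) S T f
  | invL {A B A' : C} (π : Quiver.Path A' A)
      {N : Frm p A'} {P : Frm p B} {S : Frm p A} {f : A ⟶ B} {h : A' ⟶ B}
      (hN : N.NonPos) (hP : P.NonNeg) (hS : pushSeq π N = S) (e : composePath π ≫ f = h)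
      (m : MaxMult (.foc (.left (composePath π) f)) N P h) : MaxMult (.inv .left) S P f
  | invR {A B B' : C} (ρ : Quiver.Path B B')
      {N : Frm p A} {P : Frm p B'} {T : Frm p B} {f : A ⟶ B} {h : A ⟶ B'}
      (hN : N.NonPos) (hP : P.NonNeg) (hT : pullSeq ρ P = T) (e : f ≫ composePath ρ = h)
      (m : MaxMult (.foc (.right f (composePath ρ))) N P h) : MaxMult (.inv .right) N T f
  | focL {A B X : C} (q : PreFocus A B) (σ : Quiver.Path A X)
      {P : Frm p X} {Q : Frm p B} {S : Frm p A} {g : X ⟶ B} {h : A ⟶ B}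
      (hσ : σ.length ≠ 0) (hP : P.NonNeg) (hQ : Q.NonNeg) (hS : pullSeq σ P = S)
      (e : composePath σ ≫ g = h) (hq : q.AllowsL (composePath σ) g)
      (m : MaxMult (.inv .left) P Q g) : MaxMult (.foc q) S Q h
  | focR {A B Y : C} (q : PreFocus A B) (τ : Quiver.Path Y B)
      {N : Frm p A} {M : Frm p Y} {T : Frm p B} {g : A ⟶ Y} {h : A ⟶ B}
      (hτ : τ.length ≠ 0) (hN : N.NonPos) (hM : M.NonPos) (hT : pushSeq τ M = T)
      (e : g ≫ composePath τ = h) (hq : q.AllowsR g (composePath τ))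
      (m : MaxMult (.inv .right) N M g) : MaxMult (.foc q) N T h
  | focLR {A B X Y : C} (q : PreFocus A B) (σ : Quiver.Path A X) (τ : Quiver.Path Y B)
      {P : Frm p X} {N : Frm p Y} {S : Frm p A} {T : Frm p B} {g : X ⟶ Y} {h : A ⟶ B}
      (hσ : σ.length ≠ 0) (hτ : τ.length ≠ 0) (hP : P.NonNeg) (hN : N.NonPos)
      (hS : pullSeq σ P = S) (hT : pushSeq τ N = T)
      (e : composePath σ ≫ g ≫ composePath τ = h)
      (hq : q.AllowsLR (composePath σ) g (composePath τ))
      (m : MaxMult (.inv .unlocked) P N g) : MaxMult (.foc q) S T h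

/-- The underlying derivation: states are forgotten, rules on sequences of arrows are expanded, and
bi-rules are sequentialized (the order does not matter up to permutation equivalence). -/
def MaxMult.toDeriv : {A B : C} → {q : State A B} → {S : Frm p A} → {T : Frm p B} → {f : A ⟶ B} →
    MaxMult q S T f → Deriv S T f
  | _, _, _, _, _, _, .ax _ δ hδ => .ax δ hδ
  | _, _, _, _, _, _, .inv π ρ _ _ rfl rfl e m =>
      pushLs π (pullRs ρ m.toDeriv (by simpa using e)) rfl
  | _, _, _, _, _, _, .invL π _ _ rfl e m => pushLs π m.toDeriv e
  | _, _, _, _, _, _, .invR ρ _ _ rfl e m => pullRs ρ m.toDeriv e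
  | _, _, _, _, _, _, .focL _ σ _ _ _ rfl e _ m => pullLs σ m.toDeriv e
  | _, _, _, _, _, _, .focR _ τ _ _ _ rfl e _ m => pushRs τ m.toDeriv e
  | _, _, _, _, _, _, .focLR _ σ τ _ _ _ _ rfl rfl e _ m =>
      pullLs σ (pushRs τ m.toDeriv rfl) e

/-- The arrow of `Bif p` represented by a maximally multifocused proof. -/
def MaxMult.toHom {S T : Bif p} {q : State S.base T.base} {f : S.base ⟶ T.base}
    (m : MaxMult q S.frm T.frm f) : S ⟶ T :=
  (⟨f, Quotient.mk _ m.toDeriv⟩ : Bif.Hom S T)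

theorem MaxMult.proj_map_toHom {S T : Bif p} {q : State S.base T.base} {f : S.base ⟶ T.base}
    (m : MaxMult q S.frm T.frm f) : (Bif.proj p).map m.toHom = f := rfl

end FreeBif

/-!
A derivation of `S ⊢_f T` is an interleaving of the left rules prescribed by `S` and the right rules
prescribed by `T`, and permutation equivalence exchanges adjacent left and right rules.  Maximally
multifocused proofs are a Foata-style normal form for this partial commutation: in each phase all
foci that can be brought to the root are chosen together.

The rules `L_push` and `R_pull` are invertible (`pushL_cancel`, `exists_permEq_pushL` and their
mirror images), so inversion phases are harmless.  The rules `L_pull` and `R_push` are not, as their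
premise depends on the choice of a factorization.  If fillers in `C` are unique, then dividing a
derivation by `L_pull` or `R_push` is a partial operation on permutation classes, with
a determined base arrow (`isPullLQuot_congr`, `isPushRQuot_congr`).  Hence these rules can be
cancelled (`pullL_cancel`, `pushR_cancel`), and a class divisible by both is divisible by the two
together (`exists_of_pullL_permEq_pushR`).  All this extends from single arrows to sequences.

*Injectivity* (`MaxMult.eq_of_permEq`).  The side conditions of the pre-focus states, which speak of
the next rule only, in fact exclude every forbidden focus that can be brought to the root by
permutations (`MaxMult.allowsR`, `MaxMult.allowsL`).  So two proofs with equivalent underlying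
derivations focus on the same sides, and by cancellation their premises are again equivalent.

*Surjectivity* (`exists_maxMult`).  A derivation of a neutral sequent is an axiom or can be focused
on the left or on the right (`axiom_or_focusable`).  Focusing on every side that is possible and
then inverting gives the normal form, by induction on the size of the sequent: if only the left side
can be focused on, then no right focus of the next phase permutes below the left phase, which is
what the state `L[π, f]` demands.
-/

namespace FreeBif

open Deriv

variable {C : Type u₁} [Category.{v₁} C] {D : Type u₂} [Category.{v₂} D] {p : D ⥤ C}

/-! ### Dividing a derivation by a focusing rule -/

/-- `IsPullLQuot γ hS g α`: the derivation `γ` of `pull f S ⊢ T` becomes `α`, over `g`, up to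
permutation equivalence, when its rule `L_pull[f]` is permuted down to the root and removed.  The
right rules below that rule are kept, and the base arrows of their conclusions are adjusted; this is
always possible for `R_push`, and a condition for `R_pull`.  The equation `hS` keeps the source formula a variable, so that
recursion and induction on `γ` apply. -/
def IsPullLQuot : {A B E : C} → {f : A ⟶ B} → {S : Frm p B} → {S₀ : Frm p A} → {T : Frm p E} →
    {h : A ⟶ E} → Deriv S₀ T h → S₀ = .pull f S → (g : B ⟶ E) → Deriv S T g → Prop
  | _, _, _, _, _, _, _, _, .pullL (g := g₀) _ γ _, rfl, g, α =>
      ∃ hg : g₀ = g, PermEq (hg ▸ γ) α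
  | _, B, _, _, S, _, _, _, .pushR (B := Y) (T := T) k γ _, hS, g, α =>
      ∃ (g' : B ⟶ Y) (α' : Deriv S T g') (e : g' ≫ k = g),
        IsPullLQuot γ hS g' α' ∧ PermEq α (pushR k α' e)
  | _, B, _, f, S, _, _, h, .pullR (E := Y) (T := T) k γ _, hS, g, α =>
      f ≫ g = h ∧ ∃ (g' : B ⟶ Y) (α' : Deriv S T g') (e : g ≫ k = g'),
        IsPullLQuot γ hS g' α' ∧ PermEq α (pullR k α' e)

/-- `IsPushRQuot γ hT g α`: the derivation `γ` of `S ⊢ push k T` becomes `α`, over `g`, up to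
permutation equivalence, when its rule `R_push[k]` is permuted down to the root and removed.  In this
mirror image of `IsPullLQuot`, the left rules below are adjusted, with a condition for `L_push`. -/
def IsPushRQuot : {A B E : C} → {k : B ⟶ E} → {T : Frm p B} → {S : Frm p A} → {T₀ : Frm p E} →
    {h : A ⟶ E} → Deriv S T₀ h → T₀ = .push k T → (g : A ⟶ B) → Deriv S T g → Prop
  | _, _, _, _, _, _, _, _, .pushR (g := g₀) _ γ _, rfl, g, α =>
      ∃ hg : g₀ = g, PermEq (hg ▸ γ) α
  | _, B, _, _, T, _, _, _, .pullL (B := Y) (S := S) f γ _, hT, g, α =>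
      ∃ (g' : Y ⟶ B) (α' : Deriv S T g') (e : f ≫ g' = g),
        IsPushRQuot γ hT g' α' ∧ PermEq α (pullL f α' e)
  | _, B, _, k, T, _, _, h, .pushL (A := Y) (S := S) f γ _, hT, g, α =>
      g ≫ k = h ∧ ∃ (g' : Y ⟶ B) (α' : Deriv S T g') (e : f ≫ g = g'),
        IsPushRQuot γ hT g' α' ∧ PermEq α (pushL f α' e)

/-- The defining property of a quotient by `L_pull`; here the condition in the `R_pull` case
is what makes the permutation below possible. -/
theorem IsPullLQuot.permEq {A B E : C} {f : A ⟶ B} {S : Frm p B} {T : Frm p E} {h : A ⟶ E}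
    {γ : Deriv (.pull f S) T h} {g : B ⟶ E} {α : Deriv S T g} (H : IsPullLQuot γ rfl g α) :
    ∃ e : f ≫ g = h, PermEq γ (pullL f α e) := by
  revert g
  refine ind_source_pull (motive := fun {E T h} γ => ∀ {g : B ⟶ E} {α : Deriv S T g},
    IsPullLQuot γ rfl g α → ∃ e : f ≫ g = h, PermEq γ (pullL f α e)) ?_ ?_ ?_ γ
  · intro _ _ _ _ _ _ γ e ih g α H
    obtain ⟨g', α', e', H, hα⟩ := H
    obtain ⟨e'', h'⟩ := ih H
    refine ⟨by simp [← e, ← e', ← e''], ?_⟩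
    exact ((PermEq.congr_pushR e h').trans
      (.pullL_pushR _ _ _ e' (by simp [← e, ← e', ← e'']))).trans (.congr_pullL _ hα.symm)
  · intro _ _ _ _ _ _ γ e ih g α H
    obtain ⟨hg, g', α', e', H, hα⟩ := H
    obtain ⟨e'', h'⟩ := ih H
    refine ⟨hg, ?_⟩
    exact ((PermEq.congr_pullR e h').trans (.pullL_pullR _ _ _ e' hg)).trans
      (.congr_pullL _ hα.symm)
  · intro _ _ _ _ γ e g α H
    obtain ⟨rfl, H⟩ := H
    exact ⟨e, .congr_pullL _ H⟩

/-- Quotients by `L_pull` are invariant under permutation equivalence.  The base arrow of the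
quotient is preserved because fillers in `C` are unique: this matters for the permutation of
`L_pull` with `R_pull`. -/
theorem isPullLQuot_congr (hC : FactorizationPreordered C) {A E : C} {S₀ : Frm p A} {T : Frm p E}
    {h : A ⟶ E} {γ γ' : Deriv S₀ T h} (H : PermEq γ γ') {B : C} {f : A ⟶ B} {S : Frm p B}
    (hS : S₀ = .pull f S) (g : B ⟶ E) (α : Deriv S T g) :
    IsPullLQuot γ hS g α ↔ IsPullLQuot γ' hS g α := by
  induction H generalizing B with
  | refl => exact .rfl
  | symm _ ih => exact (ih hS g α).symm
  | trans _ _ ih₁ ih₂ => exact (ih₁ hS g α).trans (ih₂ hS g α)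
  | congr_pushL => cases hS
  | congr_pushR e _ ih => simp only [IsPullLQuot, ih]
  | congr_pullL e H _ =>
      cases hS
      simp only [IsPullLQuot]
      constructor
      · rintro ⟨rfl, h⟩
        exact ⟨rfl, H.symm.trans h⟩
      · rintro ⟨rfl, h⟩
        exact ⟨rfl, H.trans h⟩
  | congr_pullR e _ ih => simp only [IsPullLQuot, ih]
  | pullL_pushR α₀ e₁ e₂ e₃ e₄ =>
      cases hS
      simp only [IsPullLQuot]
      constructor
      · rintro ⟨g', α', e', ⟨rfl, h⟩, h'⟩
        subst e₃
        subst e'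
        exact ⟨rfl, (PermEq.congr_pushR _ h).trans h'.symm⟩
      · rintro ⟨rfl, h⟩
        exact ⟨_, α₀, e₃, ⟨rfl, .refl _⟩, h.symm⟩
  | pushL_pushR => cases hS
  | pullL_pullR α₀ e₁ e₂ e₃ e₄ =>
      cases hS
      simp only [IsPullLQuot]
      constructor
      · rintro ⟨hg, g', α', e', ⟨rfl, h⟩, h'⟩
        -- both `g'` and the given premise's arrow fill the square of `L_pull` and `R_pull`
        obtain rfl := hC _ _ _ _ (e₄.trans hg.symm) (e₃.trans e'.symm)
        exact ⟨rfl, (PermEq.congr_pullR _ h).trans h'.symm⟩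
      · rintro ⟨rfl, h⟩
        exact ⟨e₄, _, α₀, e₃, ⟨rfl, .refl _⟩, h.symm⟩
  | pushL_pullR => cases hS

/-- Quotients by `R_push` are invariant under permutation equivalence.  Here uniqueness of fillers
matters for the permutation of `L_push` with `R_push`. -/
theorem isPushRQuot_congr (hC : FactorizationPreordered C) {A E : C} {S : Frm p A} {T₀ : Frm p E}
    {h : A ⟶ E} {γ γ' : Deriv S T₀ h} (H : PermEq γ γ') {B : C} {k : B ⟶ E} {T : Frm p B}
    (hT : T₀ = .push k T) (g : A ⟶ B) (α : Deriv S T g) :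
    IsPushRQuot γ hT g α ↔ IsPushRQuot γ' hT g α := by
  induction H generalizing B with
  | refl => exact .rfl
  | symm _ ih => exact (ih hT g α).symm
  | trans _ _ ih₁ ih₂ => exact (ih₁ hT g α).trans (ih₂ hT g α)
  | congr_pullR => cases hT
  | congr_pullL e _ ih => simp only [IsPushRQuot, ih]
  | congr_pushR e H _ =>
      cases hT
      simp only [IsPushRQuot]
      constructor
      · rintro ⟨rfl, h⟩
        exact ⟨rfl, H.symm.trans h⟩
      · rintro ⟨rfl, h⟩
        exact ⟨rfl, H.trans h⟩
  | congr_pushL e _ ih => simp only [IsPushRQuot, ih]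
  | pullL_pushR α₀ e₁ e₂ e₃ e₄ =>
      cases hT
      simp only [IsPushRQuot]
      constructor
      · rintro ⟨rfl, h⟩
        exact ⟨_, α₀, e₁, ⟨rfl, .refl _⟩, h.symm⟩
      · rintro ⟨g', α', e', ⟨rfl, h⟩, h'⟩
        subst e₁
        subst e'
        exact ⟨rfl, (PermEq.congr_pullL _ h).trans h'.symm⟩
  | pushL_pullR => cases hT
  | pushL_pushR α₀ e₁ e₂ e₃ e₄ =>
      cases hT
      simp only [IsPushRQuot]
      constructor
      · rintro ⟨rfl, h⟩
        exact ⟨e₂, _, α₀, e₁, ⟨rfl, .refl _⟩, h.symm⟩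
      · rintro ⟨hg, g', α', e', ⟨rfl, h⟩, h'⟩
        -- both `g'` and the given premise's arrow fill the square of `L_push` and `R_push`
        obtain rfl := hC _ _ _ _ (e₁.trans e'.symm) (e₂.trans hg.symm)
        exact ⟨rfl, (PermEq.congr_pushL _ h).trans h'.symm⟩
  | pullL_pullR => cases hT

/-- `L_pull` can be cancelled, and the base arrow of its premise is determined. -/
theorem pullL_cancel (hC : FactorizationPreordered C) {A B E : C} {f : A ⟶ B} {S : Frm p B}
    {T : Frm p E} {h : A ⟶ E} {g g' : B ⟶ E} {α : Deriv S T g} {β : Deriv S T g'}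
    {e : f ≫ g = h} {e' : f ≫ g' = h} (H : PermEq (pullL f α e) (pullL f β e')) :
    ∃ hg : g = g', PermEq (hg ▸ α) β := by
  have h₀ : IsPullLQuot (pullL f β e') rfl g' β := ⟨rfl, .refl _⟩
  exact (isPullLQuot_congr hC H rfl g' β).2 h₀

theorem pushR_cancel (hC : FactorizationPreordered C) {A B E : C} {k : B ⟶ E} {S : Frm p A}
    {T : Frm p B} {h : A ⟶ E} {g g' : A ⟶ B} {α : Deriv S T g} {β : Deriv S T g'}
    {e : g ≫ k = h} {e' : g' ≫ k = h} (H : PermEq (pushR k α e) (pushR k β e')) :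
    ∃ hg : g = g', PermEq (hg ▸ α) β := by
  have h₀ : IsPushRQuot (pushR k β e') rfl g' β := ⟨rfl, .refl _⟩
  exact (isPushRQuot_congr hC H rfl g' β).2 h₀

/-- A derivation divisible by both `L_pull` and `R_push` is divisible by the two together. -/
theorem exists_of_pullL_permEq_pushR (hC : FactorizationPreordered C) {A B E F : C} {f : A ⟶ B}
    {k : E ⟶ F} {S : Frm p B} {T : Frm p E} {h : A ⟶ F} {g : B ⟶ F} {g' : A ⟶ E}
    {α : Deriv S (.push k T) g} {β : Deriv (.pull f S) T g'}
    {e : f ≫ g = h} {e' : g' ≫ k = h} (H : PermEq (pullL f α e) (pushR k β e')) :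
    ∃ (l : B ⟶ E) (γ : Deriv S T l) (w : l ≫ k = g) (w' : f ≫ l = g'),
      PermEq α (pushR k γ w) ∧ PermEq β (pullL f γ w') := by
  have h₀ : IsPullLQuot (pullL f α e) rfl g α := ⟨rfl, .refl _⟩
  obtain ⟨l, γ, w, Hγ, hα⟩ := (isPullLQuot_congr hC H rfl g α).1 h₀
  obtain ⟨w', hβ⟩ := Hγ.permEq
  exact ⟨l, γ, w, w', hα, hβ⟩

/-! ### Inverting the invertible rules -/

/-- `L_push` can be cancelled in every base category: cutting with the unit `S ⊢_f push f S`
inverts it. -/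
theorem pushL_cancel {A B E : C} {f : A ⟶ B} {S : Frm p A} {T : Frm p E} {g : B ⟶ E} {h : A ⟶ E}
    {α β : Deriv S T h} {e e' : f ≫ g = h} (H : PermEq (pushL f α e) (pushL f β e')) :
    PermEq α β := by
  have h₁ := cut_congr_right (pushR f (idDeriv S) (Category.id_comp f)) H e
  rw [cut, cut] at h₁
  exact ((id_cut S α _).symm.trans h₁).trans (id_cut S β _)

/-- `R_pull` can be cancelled in every base category: cutting with the counit `pull k T ⊢_k T`
inverts it. -/
theorem pullR_cancel {A B E : C} {k : B ⟶ E} {S : Frm p A} {T : Frm p E} {g : A ⟶ B} {h : A ⟶ E}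
    {α β : Deriv S T h} {e e' : g ≫ k = h} (H : PermEq (pullR k α e) (pullR k β e')) :
    PermEq α β := by
  have h₁ := cut_congr_left H (pullL k (idDeriv T) (Category.comp_id k)) e
  rw [cut, cut] at h₁
  exact ((cut_id T α _).symm.trans h₁).trans (cut_id T β _)

theorem exists_permEq_pushL {A B E : C} {f : A ⟶ B} {S : Frm p A} {T : Frm p E} {g : B ⟶ E}
    (γ : Deriv (.push f S) T g) : ∃ α : Deriv S T (f ≫ g), PermEq γ (pushL f α rfl) := by
  refine ind_source_push (motive := fun {E T g} γ =>
    ∃ α : Deriv S T (f ≫ g), PermEq γ (pushL f α rfl)) ?_ ?_ ?_ γ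
  · rintro _ _ _ k _ _ γ e ⟨α, ih⟩
    exact ⟨pushR k α (by simp [← e]),
      (PermEq.congr_pushR e ih).trans (.pushL_pushR _ _ e _ _)⟩
  · rintro _ _ _ k _ _ γ e ⟨α, ih⟩
    exact ⟨pullR k α (by simp [← e]),
      (PermEq.congr_pullR e ih).trans (.pushL_pullR _ _ _ _ _)⟩
  · intro _ _ _ _ γ e
    subst e
    exact ⟨γ, .refl _⟩

theorem exists_permEq_pullR {A B E : C} {k : B ⟶ E} {S : Frm p A} {T : Frm p E} {g : A ⟶ B}
    (γ : Deriv S (.pull k T) g) : ∃ α : Deriv S T (g ≫ k), PermEq γ (pullR k α rfl) := by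
  refine ind_target_pull (motive := fun {A S g} γ =>
    ∃ α : Deriv S T (g ≫ k), PermEq γ (pullR k α rfl)) ?_ ?_ ?_ γ
  · rintro _ _ _ f _ _ γ e ⟨α, ih⟩
    exact ⟨pushL f α (by simp [← e]),
      (PermEq.congr_pushL e ih).trans (.symm (.pushL_pullR _ _ _ _ _))⟩
  · rintro _ _ _ f _ _ γ e ⟨α, ih⟩
    exact ⟨pullL f α (by simp [← e]),
      (PermEq.congr_pullL e ih).trans (.symm (.pullL_pullR _ _ _ _ _))⟩
  · intro _ _ _ _ γ e
    subst e
    exact ⟨γ, .refl _⟩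

/-! ### Rules along sequences of arrows -/

section Sequences

variable {A B E F : C}

theorem pushLs_congr {S : Frm p A} {T : Frm p E} (π : Quiver.Path A B) {g : B ⟶ E} {h : A ⟶ E}
    {α β : Deriv S T h} (e : composePath π ≫ g = h) (H : PermEq α β) :
    PermEq (pushLs π α e) (pushLs π β e) := by
  induction π with
  | nil =>
      obtain rfl : g = h := (Category.id_comp g).symm.trans e
      exact H
  | cons π f ih => exact .congr_pushL _ (ih _)

theorem pushRs_congr {S : Frm p A} {T : Frm p B} (π : Quiver.Path B E) {g : A ⟶ B} {h : A ⟶ E}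
    {α β : Deriv S T g} (e : g ≫ composePath π = h) (H : PermEq α β) :
    PermEq (pushRs π α e) (pushRs π β e) := by
  induction π with
  | nil =>
      obtain rfl : g = h := (Category.comp_id g).symm.trans e
      exact H
  | cons π f ih => exact .congr_pushR _ (ih _)

theorem pullLs_congr {S : Frm p B} {T : Frm p E} (π : Quiver.Path A B) {g : B ⟶ E} {h : A ⟶ E}
    {α β : Deriv S T g} (e : composePath π ≫ g = h) (H : PermEq α β) :
    PermEq (pullLs π α e) (pullLs π β e) := by
  induction π with
  | nil =>
      obtain rfl : g = h := (Category.id_comp g).symm.trans e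
      exact H
  | cons π f ih => exact ih _ (.congr_pullL _ H)

theorem pullRs_congr {S : Frm p A} {T : Frm p E} (π : Quiver.Path B E) {g : A ⟶ B} {h : A ⟶ E}
    {α β : Deriv S T h} (e : g ≫ composePath π = h) (H : PermEq α β) :
    PermEq (pullRs π α e) (pullRs π β e) := by
  induction π with
  | nil =>
      obtain rfl : g = h := (Category.comp_id g).symm.trans e
      exact H
  | cons π f ih => exact ih _ (.congr_pullR _ H)

/-- Like `L_push`, the rule along a sequence is invertible, for every base category. -/
theorem pushLs_cancel {S : Frm p A} {T : Frm p E} (π : Quiver.Path A B) {g : B ⟶ E} {h : A ⟶ E}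
    {α β : Deriv S T h} {e : composePath π ≫ g = h}
    (H : PermEq (pushLs π α e) (pushLs π β e)) : PermEq α β := by
  induction π with
  | nil =>
      obtain rfl : g = h := (Category.id_comp g).symm.trans e
      exact H
  | cons π f ih => exact ih (pushL_cancel H)

theorem pullRs_cancel {S : Frm p A} {T : Frm p E} (π : Quiver.Path B E) {g : A ⟶ B} {h : A ⟶ E}
    {α β : Deriv S T h} {e : g ≫ composePath π = h}
    (H : PermEq (pullRs π α e) (pullRs π β e)) : PermEq α β := by
  induction π with
  | nil =>
      obtain rfl : g = h := (Category.comp_id g).symm.trans e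
      exact H
  | cons π f ih => exact pullR_cancel (ih H)

/-- Like `L_pull`, the rule along a sequence can be cancelled and determines the base arrow of its
premise, as fillers in `C` are unique. -/
theorem pullLs_cancel (hC : FactorizationPreordered C) {S : Frm p B} {T : Frm p E}
    (π : Quiver.Path A B) {g g' : B ⟶ E} {h : A ⟶ E} {α : Deriv S T g} {β : Deriv S T g'}
    {e : composePath π ≫ g = h} {e' : composePath π ≫ g' = h}
    (H : PermEq (pullLs π α e) (pullLs π β e')) : ∃ hg : g = g', PermEq (hg ▸ α) β := by
  induction π with
  | nil =>
      obtain rfl : g = h := (Category.id_comp g).symm.trans e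
      obtain rfl : g' = g := (Category.id_comp g').symm.trans e'
      exact ⟨rfl, H⟩
  | cons π f ih =>
      obtain ⟨hg, H⟩ := ih H
      have key : ∀ {k k' : _ ⟶ E} (hk : k = k') (h₁ : f ≫ g = k) (h₂ : f ≫ g' = k'),
          PermEq (hk ▸ pullL f α h₁) (pullL f β h₂) → ∃ hg : g = g', PermEq (hg ▸ α) β := by
        rintro _ _ rfl h₁ h₂ H
        exact pullL_cancel hC H
      exact key hg rfl rfl H

theorem pushRs_cancel (hC : FactorizationPreordered C) {S : Frm p A} {T : Frm p B}
    (π : Quiver.Path B E) {g g' : A ⟶ B} {h : A ⟶ E} {α : Deriv S T g} {β : Deriv S T g'}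
    {e : g ≫ composePath π = h} {e' : g' ≫ composePath π = h}
    (H : PermEq (pushRs π α e) (pushRs π β e')) : ∃ hg : g = g', PermEq (hg ▸ α) β := by
  induction π with
  | nil =>
      obtain rfl : g = h := (Category.comp_id g).symm.trans e
      obtain rfl : g' = g := (Category.comp_id g').symm.trans e'
      exact ⟨rfl, H⟩
  | cons π f ih =>
      obtain ⟨hg, H⟩ := pushR_cancel hC H
      have key : ∀ {k k' : A ⟶ _} (hk : k = k') (h₁ : g ≫ composePath π = k)
          (h₂ : g' ≫ composePath π = k'), PermEq (hk ▸ pushRs π α h₁) (pushRs π β h₂) →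
          ∃ hg : g = g', PermEq (hg ▸ α) β := by
        rintro _ _ rfl h₁ h₂ H
        exact ih H
      exact key hg rfl rfl H

theorem exists_permEq_pushLs {S : Frm p A} {T : Frm p E} (π : Quiver.Path A B) {g : B ⟶ E}
    {h : A ⟶ E} (e : composePath π ≫ g = h) (γ : Deriv (pushSeq π S) T g) :
    ∃ α : Deriv S T h, PermEq γ (pushLs π α e) := by
  induction π with
  | nil =>
      obtain rfl : g = h := (Category.id_comp g).symm.trans e
      exact ⟨γ, .refl _⟩
  | cons π f ih =>
      obtain ⟨γ', H⟩ := exists_permEq_pushL γ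
      obtain ⟨α, H'⟩ := ih (by simpa using e) γ'
      exact ⟨α, H.trans (.congr_pushL _ H')⟩

theorem exists_permEq_pullRs {S : Frm p A} {T : Frm p E} (π : Quiver.Path B E) {g : A ⟶ B}
    {h : A ⟶ E} (e : g ≫ composePath π = h) (γ : Deriv S (pullSeq π T) g) :
    ∃ α : Deriv S T h, PermEq γ (pullRs π α e) := by
  induction π with
  | nil =>
      obtain rfl : g = h := (Category.comp_id g).symm.trans e
      exact ⟨γ, .refl _⟩
  | cons π f ih =>
      obtain ⟨γ', H⟩ := ih rfl γ
      obtain ⟨α, H'⟩ := exists_permEq_pullR γ'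
      obtain rfl : (g ≫ composePath π) ≫ f = h := by simpa using e
      exact ⟨α, H.trans (pullRs_congr π _ H')⟩

theorem pushL_pushRs {B' : C} {S : Frm p A} {T : Frm p B'} {f : A ⟶ B} (τ : Quiver.Path B' E)
    {l : A ⟶ B'} {g : B ⟶ B'} {h : B ⟶ E} {k : A ⟶ E} (α : Deriv S T l) (e₁ : f ≫ g = l)
    (e₂ : g ≫ composePath τ = h) (e₃ : l ≫ composePath τ = k) (e₄ : f ≫ h = k) :
    PermEq (pushRs τ (pushL f α e₁) e₂) (pushL f (pushRs τ α e₃) e₄) := by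
  induction τ with
  | nil =>
      obtain rfl : g = h := (Category.comp_id g).symm.trans e₂
      obtain rfl : l = k := (Category.comp_id l).symm.trans e₃
      exact .refl _
  | cons τ t ih =>
      exact (PermEq.congr_pushR _ (ih rfl rfl (by simp [← e₁]))).trans (.pushL_pushR _ _ _ _ _)

theorem pushLs_pushRs {B' : C} {S : Frm p A} {T : Frm p B'} (π : Quiver.Path A B)
    (τ : Quiver.Path B' E) {l : A ⟶ B'} {g : B ⟶ B'} {h : B ⟶ E} {k : A ⟶ E} (α : Deriv S T l)
    (e₁ : composePath π ≫ g = l) (e₂ : g ≫ composePath τ = h) (e₃ : l ≫ composePath τ = k)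
    (e₄ : composePath π ≫ h = k) :
    PermEq (pushRs τ (pushLs π α e₁) e₂) (pushLs π (pushRs τ α e₃) e₄) := by
  induction π with
  | nil =>
      obtain rfl : g = l := (Category.id_comp g).symm.trans e₁
      obtain rfl : h = k := (Category.id_comp h).symm.trans e₄
      exact .refl _
  | cons π f ih =>
      exact (pushL_pushRs τ _ _ _ (by simp [← e₂]) rfl).trans
        (.congr_pushL _ (ih _ _ _))

theorem pullL_pushRs {B' : C} {S : Frm p B} {T : Frm p B'} {f : A ⟶ B} (τ : Quiver.Path B' E)
    {l : A ⟶ B'} {g : B ⟶ B'} {h : B ⟶ E} {k : A ⟶ E} (α : Deriv S T g) (e₁ : f ≫ g = l)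
    (e₂ : l ≫ composePath τ = k) (e₃ : g ≫ composePath τ = h) (e₄ : f ≫ h = k) :
    PermEq (pushRs τ (pullL f α e₁) e₂) (pullL f (pushRs τ α e₃) e₄) := by
  induction τ with
  | nil =>
      obtain rfl : g = h := (Category.comp_id g).symm.trans e₃
      obtain rfl : l = k := (Category.comp_id l).symm.trans e₂
      exact .refl _
  | cons τ t ih =>
      exact (PermEq.congr_pushR _ (ih rfl rfl (by simp [← e₁]))).trans (.pullL_pushR _ _ _ _ _)

theorem pullLs_pushRs {B' : C} {S : Frm p B} {T : Frm p B'} (σ : Quiver.Path A B)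
    (τ : Quiver.Path B' E) {l : A ⟶ B'} {g : B ⟶ B'} {h : B ⟶ E} {k : A ⟶ E} (α : Deriv S T g)
    (e₁ : composePath σ ≫ g = l) (e₂ : l ≫ composePath τ = k) (e₃ : g ≫ composePath τ = h)
    (e₄ : composePath σ ≫ h = k) :
    PermEq (pushRs τ (pullLs σ α e₁) e₂) (pullLs σ (pushRs τ α e₃) e₄) := by
  induction σ with
  | nil =>
      obtain rfl : g = l := (Category.id_comp g).symm.trans e₁
      obtain rfl : h = k := (Category.id_comp h).symm.trans e₄
      exact .refl _
  | cons σ f ih =>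
      exact (ih _ _ (by simp [← e₃]) _).trans (pullLs_congr σ _ (pullL_pushRs τ _ _ _ _ _))

theorem pullL_pullRs {B' : C} {S : Frm p B} {T : Frm p E} {f : A ⟶ B} (ρ : Quiver.Path B' E)
    {l : A ⟶ B'} {g : B ⟶ B'} {h : B ⟶ E} {k : A ⟶ E} (α : Deriv S T h) (e₁ : f ≫ h = k)
    (e₂ : l ≫ composePath ρ = k) (e₃ : g ≫ composePath ρ = h) (e₄ : f ≫ g = l) :
    PermEq (pullRs ρ (pullL f α e₁) e₂) (pullL f (pullRs ρ α e₃) e₄) := by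
  induction ρ with
  | nil =>
      obtain rfl : g = h := (Category.comp_id g).symm.trans e₃
      obtain rfl : l = k := (Category.comp_id l).symm.trans e₂
      exact .refl _
  | cons ρ t ih =>
      exact (pullRs_congr ρ _ (.pullL_pullR _ _ _ (by simpa using e₃) (by simp [← e₄]))).trans
        (ih _ _ _ _)

theorem pullLs_pullRs {B' : C} {S : Frm p B} {T : Frm p E} (σ : Quiver.Path A B)
    (ρ : Quiver.Path B' E) {l : A ⟶ B'} {g : B ⟶ B'} {h : B ⟶ E} {k : A ⟶ E} (α : Deriv S T h)
    (e₁ : composePath σ ≫ h = k) (e₂ : l ≫ composePath ρ = k) (e₃ : g ≫ composePath ρ = h)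
    (e₄ : composePath σ ≫ g = l) :
    PermEq (pullRs ρ (pullLs σ α e₁) e₂) (pullLs σ (pullRs ρ α e₃) e₄) := by
  induction σ with
  | nil =>
      obtain rfl : h = k := (Category.id_comp h).symm.trans e₁
      obtain rfl : g = l := (Category.id_comp g).symm.trans e₄
      exact .refl _
  | cons σ f ih =>
      exact (ih _ _ (by simp [← e₃]) (by simpa using e₄)).trans
        (pullLs_congr σ _ (pullL_pullRs ρ _ _ _ _ _))

theorem exists_of_pullL_permEq_pushRs (hC : FactorizationPreordered C) {B' : C} {f : A ⟶ B}
    (τ : Quiver.Path B' E) {S : Frm p B} {T : Frm p B'} {h : A ⟶ E} {g : B ⟶ E} {g' : A ⟶ B'}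
    {α : Deriv S (pushSeq τ T) g} {β : Deriv (.pull f S) T g'}
    {e : f ≫ g = h} {e' : g' ≫ composePath τ = h} (H : PermEq (pullL f α e) (pushRs τ β e')) :
    ∃ (l : B ⟶ B') (γ : Deriv S T l) (w : l ≫ composePath τ = g) (w' : f ≫ l = g'),
      PermEq α (pushRs τ γ w) ∧ PermEq β (pullL f γ w') := by
  induction τ with
  | nil =>
      obtain rfl : g' = h := (Category.comp_id g').symm.trans e'
      exact ⟨g, α, Category.comp_id g, e, .refl _, H.symm⟩
  | cons τ t ih =>
      obtain ⟨l₁, γ₁, w₁, w₁', h₁, h₁'⟩ := exists_of_pullL_permEq_pushR hC H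
      obtain ⟨l, γ, w, w', h₂, h₂'⟩ := ih h₁'.symm
      subst w
      exact ⟨l, γ, by simpa using w₁, w', h₁.trans (.congr_pushR _ h₂), h₂'⟩

/-- A derivation divisible by both `L_pull[σ]` and `R_push[τ]` is divisible by the two together. -/
theorem exists_of_pullLs_permEq_pushRs (hC : FactorizationPreordered C) {B' : C}
    (σ : Quiver.Path A B) (τ : Quiver.Path B' E) {S : Frm p B} {T : Frm p B'} {h : A ⟶ E}
    {g : B ⟶ E} {g' : A ⟶ B'} {α : Deriv S (pushSeq τ T) g} {β : Deriv (pullSeq σ S) T g'}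
    {e : composePath σ ≫ g = h} {e' : g' ≫ composePath τ = h}
    (H : PermEq (pullLs σ α e) (pushRs τ β e')) :
    ∃ (l : B ⟶ B') (γ : Deriv S T l) (w : l ≫ composePath τ = g) (w' : composePath σ ≫ l = g'),
      PermEq α (pushRs τ γ w) ∧ PermEq β (pullLs σ γ w') := by
  induction σ with
  | nil =>
      obtain rfl : g = h := (Category.id_comp g).symm.trans e
      exact ⟨g', β, e', Category.id_comp g', H, .refl _⟩
  | cons σ f ih =>
      obtain ⟨l₁, γ₁, w₁, w₁', h₁, h₁'⟩ := ih H
      obtain ⟨l, γ, w, w', h₂, h₂'⟩ := exists_of_pullL_permEq_pushRs hC τ h₁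
      subst w'
      exact ⟨l, γ, w, by simpa using w₁', h₂, h₁'.trans (pullLs_congr σ _ h₂')⟩

end Sequences

/-! ### Splitting off the outermost pushes or pulls of a formula -/

/-- The maximal sequence of outermost pushes of a formula, and the formula below it. -/
def splitPush : {A : C} → Frm p A → Σ X : C, Quiver.Path X A × Frm p X
  | _, .push f S => ⟨(splitPush S).1, (splitPush S).2.1.cons f, (splitPush S).2.2⟩
  | A, .atom X hX => ⟨A, .nil, .atom X hX⟩
  | A, .pull g S => ⟨A, .nil, .pull g S⟩

/-- The maximal sequence of outermost pulls of a formula, and the formula below it. -/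
def splitPull : {A : C} → Frm p A → Σ X : C, Quiver.Path A X × Frm p X
  | _, .pull f S => ⟨(splitPull S).1, f.toPath.comp (splitPull S).2.1, (splitPull S).2.2⟩
  | A, .atom X hX => ⟨A, .nil, .atom X hX⟩
  | A, .push g S => ⟨A, .nil, .push g S⟩

theorem pullSeq_toPath_comp {A B E : C} (f : A ⟶ B) (σ : Quiver.Path B E) (S : Frm p E) :
    pullSeq (f.toPath.comp σ) S = .pull f (pullSeq σ S) := by
  induction σ with
  | nil => rfl
  | cons σ g ih => exact ih (.pull g S)

theorem splitPush_pushSeq {A B : C} (π : Quiver.Path A B) {N : Frm p A} (hN : N.NonPos) :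
    splitPush (pushSeq π N) = ⟨A, π, N⟩ := by
  induction π with
  | nil => cases N with
    | push => exact hN.elim
    | _ => rfl
  | cons π f ih => rw [pushSeq, splitPush, ih]

theorem splitPull_pullSeq {A B : C} (σ : Quiver.Path A B) (S : Frm p B) :
    splitPull (pullSeq σ S) =
      ⟨(splitPull S).1, σ.comp (splitPull S).2.1, (splitPull S).2.2⟩ := by
  induction σ with
  | nil => simp [pullSeq]
  | cons σ f ih =>
      rw [pullSeq, ih, splitPull, ← Quiver.Path.comp_assoc]
      rfl

theorem splitPull_pullSeq_of_nonNeg {A B : C} (σ : Quiver.Path A B) {P : Frm p B}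
    (hP : P.NonNeg) : splitPull (pullSeq σ P) = ⟨B, σ, P⟩ := by
  rw [splitPull_pullSeq]
  cases P with
  | pull => exact hP.elim
  | _ => rfl

theorem pushSeq_injective {A B A' : C} {π : Quiver.Path A B} {π' : Quiver.Path A' B}
    {N : Frm p A} {N' : Frm p A'} (hN : N.NonPos) (hN' : N'.NonPos)
    (h : pushSeq π N = pushSeq π' N') :
    (⟨A, π, N⟩ : Σ X : C, Quiver.Path X B × Frm p X) = ⟨A', π', N'⟩ := by
  rw [← splitPush_pushSeq π hN, h, splitPush_pushSeq π' hN']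

theorem pullSeq_injective {A B B' : C} {σ : Quiver.Path A B} {σ' : Quiver.Path A B'}
    {P : Frm p B} {P' : Frm p B'} (hP : P.NonNeg) (hP' : P'.NonNeg)
    (h : pullSeq σ P = pullSeq σ' P') :
    (⟨B, σ, P⟩ : Σ X : C, Quiver.Path A X × Frm p X) = ⟨B', σ', P'⟩ := by
  rw [← splitPull_pullSeq_of_nonNeg σ hP, h, splitPull_pullSeq_of_nonNeg σ' hP']

theorem pushSeq_ne_atom {A B : C} {τ : Quiver.Path A B} {S : Frm p A} {X : D} {hX : p.obj X = B}
    (hτ : τ.length ≠ 0) : pushSeq τ S ≠ .atom X hX := by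
  cases τ with
  | nil => exact (hτ rfl).elim
  | cons τ t => nofun

theorem pullSeq_ne_atom {A B : C} {σ : Quiver.Path A B} {P : Frm p B} {X : D} {hX : p.obj X = A}
    (hσ : σ.length ≠ 0) (hP : P.NonNeg) : pullSeq σ P ≠ .atom X hX := by
  intro h
  cases pullSeq_injective (σ' := .nil) (P' := .atom X hX) hP trivial h
  exact hσ rfl

theorem exists_eq_pushSeq {A : C} (S : Frm p A) :
    ∃ (X : C) (π : Quiver.Path X A) (N : Frm p X), N.NonPos ∧ pushSeq π N = S := by
  induction S with
  | push f S ih =>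
      obtain ⟨X, π, N, hN, rfl⟩ := ih
      exact ⟨X, π.cons f, N, hN, rfl⟩
  | atom X hX => exact ⟨_, .nil, .atom X hX, trivial, rfl⟩
  | pull g S => exact ⟨_, .nil, .pull g S, trivial, rfl⟩

theorem exists_eq_pullSeq {A : C} (S : Frm p A) :
    ∃ (X : C) (σ : Quiver.Path A X) (P : Frm p X), P.NonNeg ∧ pullSeq σ P = S := by
  induction S with
  | pull f S ih =>
      obtain ⟨X, σ, P, hP, rfl⟩ := ih
      exact ⟨X, f.toPath.comp σ, P, hP, pullSeq_toPath_comp f σ P⟩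
  | atom X hX => exact ⟨_, .nil, .atom X hX, trivial, rfl⟩
  | push g S => exact ⟨_, .nil, .push g S, trivial, rfl⟩

/-- The number of connectives of a formula. -/
def Frm.size : {A : C} → Frm p A → ℕ
  | _, .atom _ _ => 0
  | _, .push _ S => S.size + 1
  | _, .pull _ S => S.size + 1

theorem size_pushSeq {A B : C} (π : Quiver.Path A B) (S : Frm p A) :
    (pushSeq π S).size = S.size + π.length := by
  induction π with
  | nil => rfl
  | cons π f ih => simp [pushSeq, Frm.size, ih, Nat.add_assoc]

theorem size_pullSeq {A B : C} (σ : Quiver.Path A B) (S : Frm p B) :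
    (pullSeq σ S).size = S.size + σ.length := by
  induction σ with
  | nil => rfl
  | cons σ f ih =>
      simp only [pullSeq, ih, Frm.size, Quiver.Path.length_cons]
      omega

/-! ### Derivations that can be focused -/

section Focusable

variable {A B E X Y : C}

/-- `LeftFocusable α σ g`: the source of `α` is `pull_σ P` with `σ` non-empty and maximal, and `α`
is permutation equivalent to a derivation that ends with `L_pull[σ]` with premise over `g`. -/
def LeftFocusable {S : Frm p A} {T : Frm p B} {h : A ⟶ B} (α : Deriv S T h)
    (σ : Quiver.Path A X) (g : X ⟶ B) : Prop :=
  σ.length ≠ 0 ∧ ∃ (P : Frm p X) (β : Deriv P T g) (e : composePath σ ≫ g = h),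
    P.NonNeg ∧ ∃ hS : pullSeq σ P = S, PermEq α (hS ▸ pullLs σ β e)

/-- `RightFocusable α g τ`: the target of `α` is `push_τ M` with `τ` non-empty and maximal, and `α`
is permutation equivalent to a derivation that ends with `R_push[τ]` with premise over `g`. -/
def RightFocusable {S : Frm p A} {T : Frm p B} {h : A ⟶ B} (α : Deriv S T h)
    (g : A ⟶ Y) (τ : Quiver.Path Y B) : Prop :=
  τ.length ≠ 0 ∧ ∃ (M : Frm p Y) (β : Deriv S M g) (e : g ≫ composePath τ = h),
    M.NonPos ∧ ∃ hT : pushSeq τ M = T, PermEq α (hT ▸ pushRs τ β e)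

theorem LeftFocusable.congr {S : Frm p A} {T : Frm p B} {h : A ⟶ B} {α α' : Deriv S T h}
    {σ : Quiver.Path A X} {g : X ⟶ B} (H : LeftFocusable α σ g) (h' : PermEq α α') :
    LeftFocusable α' σ g := by
  obtain ⟨hσ, P, β, e, hP, hS, H⟩ := H
  exact ⟨hσ, P, β, e, hP, hS, h'.symm.trans H⟩

theorem RightFocusable.congr {S : Frm p A} {T : Frm p B} {h : A ⟶ B} {α α' : Deriv S T h}
    {g : A ⟶ Y} {τ : Quiver.Path Y B} (H : RightFocusable α g τ) (h' : PermEq α α') :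
    RightFocusable α' g τ := by
  obtain ⟨hτ, M, β, e, hM, hT, H⟩ := H
  exact ⟨hτ, M, β, e, hM, hT, h'.symm.trans H⟩

theorem leftFocusable_pullLs {P : Frm p X} {T : Frm p B} {h : A ⟶ B} {σ : Quiver.Path A X}
    {g : X ⟶ B} (hσ : σ.length ≠ 0) (hP : P.NonNeg) (β : Deriv P T g)
    (e : composePath σ ≫ g = h) : LeftFocusable (pullLs σ β e) σ g :=
  ⟨hσ, P, β, e, hP, rfl, .refl _⟩

theorem rightFocusable_pushRs {S : Frm p A} {M : Frm p Y} {h : A ⟶ B} {g : A ⟶ Y}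
    {τ : Quiver.Path Y B} (hτ : τ.length ≠ 0) (hM : M.NonPos) (β : Deriv S M g)
    (e : g ≫ composePath τ = h) : RightFocusable (pushRs τ β e) g τ :=
  ⟨hτ, M, β, e, hM, rfl, .refl _⟩

/-- There is at most one way to focus on the left. -/
theorem LeftFocusable.unique (hC : FactorizationPreordered C) {X' : C} {S : Frm p A} {T : Frm p B}
    {h : A ⟶ B} {α : Deriv S T h} {σ : Quiver.Path A X} {g : X ⟶ B} {σ' : Quiver.Path A X'}
    {g' : X' ⟶ B} (H : LeftFocusable α σ g) (H' : LeftFocusable α σ' g') :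
    (⟨X, σ, g⟩ : Σ X : C, Quiver.Path A X × (X ⟶ B)) = ⟨X', σ', g'⟩ := by
  obtain ⟨-, P, β, e, hP, rfl, H⟩ := H
  obtain ⟨-, P', β', e', hP', hS, H'⟩ := H'
  cases pullSeq_injective hP hP' hS.symm
  obtain ⟨rfl, -⟩ := pullLs_cancel hC σ (H.symm.trans H')
  rfl

/-- There is at most one way to focus on the right. -/
theorem RightFocusable.unique (hC : FactorizationPreordered C) {Y' : C} {S : Frm p A}
    {T : Frm p B} {h : A ⟶ B} {α : Deriv S T h} {g : A ⟶ Y} {τ : Quiver.Path Y B} {g' : A ⟶ Y'}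
    {τ' : Quiver.Path Y' B} (H : RightFocusable α g τ) (H' : RightFocusable α g' τ') :
    (⟨Y, g, τ⟩ : Σ Y : C, (A ⟶ Y) × Quiver.Path Y B) = ⟨Y', g', τ'⟩ := by
  obtain ⟨-, M, β, e, hM, rfl, H⟩ := H
  obtain ⟨-, M', β', e', hM', hT, H'⟩ := H'
  cases pushSeq_injective hM hM' hT.symm
  obtain ⟨rfl, -⟩ := pushRs_cancel hC τ (H.symm.trans H')
  rfl

/-- A right focus permutes above a left focus. -/
theorem RightFocusable.of_pullLs (hC : FactorizationPreordered C) {S : Frm p X} {T : Frm p B}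
    {h : A ⟶ B} {σ : Quiver.Path A X} {k : X ⟶ B} {α : Deriv S T k} {e : composePath σ ≫ k = h}
    {g : A ⟶ Y} {τ : Quiver.Path Y B} (H : RightFocusable (pullLs σ α e) g τ) :
    ∃ l : X ⟶ Y, RightFocusable α l τ := by
  obtain ⟨hτ, M, β, e', hM, rfl, H⟩ := H
  obtain ⟨l, γ, w, -, H, -⟩ := exists_of_pullLs_permEq_pushRs hC σ τ H
  exact ⟨l, hτ, M, γ, w, hM, rfl, H⟩

/-- A left focus permutes above a right focus. -/
theorem LeftFocusable.of_pushRs (hC : FactorizationPreordered C) {S : Frm p A} {T : Frm p Y}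
    {h : A ⟶ B} {τ : Quiver.Path Y B} {k : A ⟶ Y} {α : Deriv S T k} {e : k ≫ composePath τ = h}
    {g : X ⟶ B} {σ : Quiver.Path A X} (H : LeftFocusable (pushRs τ α e) σ g) :
    ∃ l : X ⟶ Y, LeftFocusable α σ l := by
  obtain ⟨hσ, P, β, e', hP, rfl, H⟩ := H
  obtain ⟨l, γ, -, w, -, H⟩ := exists_of_pullLs_permEq_pushRs hC σ τ H.symm
  exact ⟨l, hσ, P, γ, w, hP, rfl, H⟩

theorem RightFocusable.pullLs {S : Frm p X} {T : Frm p B} {h : A ⟶ B} {σ : Quiver.Path A X}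
    {k : X ⟶ B} {α : Deriv S T k} {l : X ⟶ Y} {τ : Quiver.Path Y B}
    (H : RightFocusable α l τ) (e : composePath σ ≫ k = h) :
    RightFocusable (pullLs σ α e) (composePath σ ≫ l) τ := by
  obtain ⟨hτ, M, β, e', hM, rfl, H⟩ := H
  exact ⟨hτ, M, FreeBif.pullLs σ β rfl, by simp [← e, ← e'], hM, rfl,
    (pullLs_congr σ e H).trans (pullLs_pushRs σ τ _ _ _ _ _).symm⟩

theorem LeftFocusable.pushRs {S : Frm p A} {T : Frm p Y} {h : A ⟶ B} {τ : Quiver.Path Y B}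
    {k : A ⟶ Y} {α : Deriv S T k} {l : X ⟶ Y} {σ : Quiver.Path A X}
    (H : LeftFocusable α σ l) (e : k ≫ composePath τ = h) :
    LeftFocusable (pushRs τ α e) σ (l ≫ composePath τ) := by
  obtain ⟨hσ, P, β, e', hP, rfl, H⟩ := H
  exact ⟨hσ, P, FreeBif.pushRs τ β rfl, by simp [← e, ← e'], hP, rfl,
    (pushRs_congr τ e H).trans (pullLs_pushRs σ τ _ _ _ _ _)⟩

theorem RightFocusable.of_pushLs {S : Frm p X} {T : Frm p B} {h : X ⟶ B} {π : Quiver.Path X A}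
    {k : A ⟶ B} {α : Deriv S T h} {e : composePath π ≫ k = h}
    {g : A ⟶ Y} {τ : Quiver.Path Y B} (H : RightFocusable (pushLs π α e) g τ) :
    g ≫ composePath τ = k ∧ RightFocusable α (composePath π ≫ g) τ := by
  obtain ⟨hτ, M, β, e', hM, rfl, H⟩ := H
  obtain ⟨γ, Hγ⟩ := exists_permEq_pushLs π rfl β
  refine ⟨e', hτ, M, γ, by simp [e', e], hM, rfl, pushLs_cancel π (e := e) ?_⟩
  exact (H.trans (pushRs_congr τ e' Hγ)).trans (pushLs_pushRs π τ _ _ _ _ _)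

theorem LeftFocusable.of_pullRs {S : Frm p A} {T : Frm p Y} {h : A ⟶ Y} {ρ : Quiver.Path B Y}
    {k : A ⟶ B} {α : Deriv S T h} {e : k ≫ composePath ρ = h}
    {g : X ⟶ B} {σ : Quiver.Path A X} (H : LeftFocusable (pullRs ρ α e) σ g) :
    composePath σ ≫ g = k ∧ LeftFocusable α σ (g ≫ composePath ρ) := by
  obtain ⟨hσ, P, β, e', hP, rfl, H⟩ := H
  obtain ⟨γ, Hγ⟩ := exists_permEq_pullRs ρ rfl β
  refine ⟨e', hσ, P, γ, by simp [← e, ← e'], hP, rfl, pullRs_cancel ρ (e := e) ?_⟩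
  exact (H.trans (pullLs_congr σ e' Hγ)).trans (pullLs_pullRs σ ρ _ _ _ _ _).symm

/-- A right focus permutes below a left inversion if the corresponding filler exists. -/
theorem RightFocusable.pushLs {S : Frm p X} {T : Frm p B} {h : X ⟶ B} {π : Quiver.Path X A}
    {k : A ⟶ B} {α : Deriv S T h} {g : A ⟶ Y} {τ : Quiver.Path Y B}
    (H : RightFocusable α (composePath π ≫ g) τ) (e : composePath π ≫ k = h)
    (w : g ≫ composePath τ = k) : RightFocusable (pushLs π α e) g τ := by
  obtain ⟨hτ, M, β, e', hM, rfl, H⟩ := H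
  exact ⟨hτ, M, FreeBif.pushLs π β rfl, w, hM, rfl,
    (pushLs_congr π e H).trans (pushLs_pushRs π τ _ _ _ _ _).symm⟩

/-- A left focus permutes below a right inversion if the corresponding filler exists. -/
theorem LeftFocusable.pullRs {S : Frm p A} {T : Frm p Y} {h : A ⟶ Y} {ρ : Quiver.Path B Y}
    {k : A ⟶ B} {α : Deriv S T h} {g : X ⟶ B} {σ : Quiver.Path A X}
    (H : LeftFocusable α σ (g ≫ composePath ρ)) (e : k ≫ composePath ρ = h)
    (w : composePath σ ≫ g = k) : LeftFocusable (pullRs ρ α e) σ g := by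
  obtain ⟨hσ, P, β, e', hP, rfl, H⟩ := H
  exact ⟨hσ, P, FreeBif.pullRs ρ β rfl, w, hP, rfl,
    (pullRs_congr ρ e H).trans (pullLs_pullRs σ ρ _ _ _ _ _)⟩

theorem not_rightFocusable_atom {S : Frm p A} {Z : D} {hZ : p.obj Z = B} {h : A ⟶ B}
    {α : Deriv S (.atom Z hZ) h} {g : A ⟶ Y} {τ : Quiver.Path Y B} :
    ¬ RightFocusable α g τ := by
  rintro ⟨hτ, M, -, -, -, hT, -⟩
  exact pushSeq_ne_atom hτ hT

theorem not_leftFocusable_atom {T : Frm p B} {Z : D} {hZ : p.obj Z = A} {h : A ⟶ B}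
    {α : Deriv (.atom Z hZ) T h} {σ : Quiver.Path A X} {g : X ⟶ B} :
    ¬ LeftFocusable α σ g := by
  rintro ⟨hσ, P, -, -, hP, hS, -⟩
  exact pullSeq_ne_atom hσ hP hS

end Focusable

/-! ### Focalization -/

theorem pullLs_toPath {A B E : C} {f : A ⟶ B} {S : Frm p B} {T : Frm p E} {g : B ⟶ E} {h : A ⟶ E}
    (α : Deriv S T g) (e : f ≫ g = h) :
    pullLs f.toPath α ((congrArg (· ≫ g) (composePath_toPath f)).trans e) = pullL f α e := by
  subst e
  rfl

theorem pushRs_toPath {A B E : C} {f : B ⟶ E} {S : Frm p A} {T : Frm p B} {g : A ⟶ B} {h : A ⟶ E}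
    (α : Deriv S T g) (e : g ≫ f = h) :
    pushRs f.toPath α ((congrArg (g ≫ ·) (composePath_toPath f)).trans e) = pushR f α e := by
  subst e
  have key : ∀ {k : A ⟶ B} (hk : g = k) (w : k ≫ f = g ≫ f),
      pushR f (hk ▸ α) w = pushR f α rfl := by
    rintro _ rfl _
    rfl
  exact key (Category.comp_id g).symm _

/-- As `pullLs` recurses on the last arrow of a sequence, a rule on the first arrow splits off only
up to the propositional equality `pullSeq_toPath_comp` of the source formulas. -/
theorem pullLs_toPath_comp {A B E F : C} {f : A ⟶ B} {S : Frm p E} {T : Frm p F}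
    (σ : Quiver.Path B E) {g : E ⟶ F} {k : B ⟶ F} {h : A ⟶ F} (β : Deriv S T g)
    (e : composePath (f.toPath.comp σ) ≫ g = h) (e₁ : composePath σ ≫ g = k) (e₂ : f ≫ k = h) :
    pullLs (f.toPath.comp σ) β e ≍ pullL f (pullLs σ β e₁) e₂ := by
  induction σ with
  | nil =>
      obtain rfl : g = k := (Category.id_comp g).symm.trans e₁
      subst e₂
      rfl
  | cons σ s ih => exact ih _ _ _

/-- An `L_pull` below a left focus on `σ` extends it to a left focus on the longer sequence. -/
theorem LeftFocusable.pullL {A B E X : C} {f : A ⟶ B} {S : Frm p B} {T : Frm p E} {k : B ⟶ E}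
    {h : A ⟶ E} {α : Deriv S T k} {σ : Quiver.Path B X} {g : X ⟶ E} (H : LeftFocusable α σ g)
    (e : f ≫ k = h) : LeftFocusable (pullL f α e) (f.toPath.comp σ) g := by
  obtain ⟨hσ, P, β, e', hP, rfl, H⟩ := H
  refine ⟨by simp, P, β, by simp [e', e], hP, pullSeq_toPath_comp f σ P, ?_⟩
  refine (PermEq.congr_pullL e H).trans ?_
  -- the source formula becomes a variable, so that the heterogeneous equality can be eliminated
  have key : ∀ {S' : Frm p A} (hS : pullSeq (f.toPath.comp σ) P = S') (δ : Deriv S' T h)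
      (e'' : composePath (f.toPath.comp σ) ≫ g = h), pullLs (f.toPath.comp σ) β e'' ≍ δ →
      PermEq δ (hS ▸ pullLs (f.toPath.comp σ) β e'') := by
    rintro _ rfl δ e'' hδ
    rw [eq_of_heq hδ]
    exact .refl _
  exact key _ _ _ (pullLs_toPath_comp σ β _ e' e)

/-- A derivation of a neutral sequent is an axiom, or it can be focused on one of the two sides. -/
theorem axiom_or_focusable {A B : C} {S : Frm p A} {T : Frm p B} {h : A ⟶ B} (α : Deriv S T h)
    (hS : S.NonPos) (hT : T.NonNeg) :
    (S.size = 0 ∧ T.size = 0) ∨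
      (∃ (X : C) (σ : Quiver.Path A X) (g : X ⟶ B), LeftFocusable α σ g) ∨
      ∃ (Y : C) (g : A ⟶ Y) (τ : Quiver.Path Y B), RightFocusable α g τ := by
  induction α with
  | ax δ hδ => exact .inl ⟨rfl, rfl⟩
  | pushL => exact hS.elim
  | pullR => exact hT.elim
  | @pullL A B E S T f g h α e ih =>
      refine .inr ?_
      by_cases hS' : S.NonNeg
      · rw [← pullLs_toPath]
        exact .inl ⟨_, _, _, leftFocusable_pullLs (by simp) hS' α _⟩
      -- `S` is a pull formula, so the premise is again neutral
      have hS'' : S.NonPos := by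
        cases S with
        | pull => trivial
        | _ => exact (hS' trivial).elim
      obtain h | ⟨X, σ, g', H⟩ | ⟨Y, g', τ, H⟩ := ih hS'' hT
      · cases S with
        | pull => cases h.1
        | _ => exact (hS' trivial).elim
      · exact .inl ⟨X, _, g', H.pullL e⟩
      · rw [← pullLs_toPath]
        exact .inr ⟨Y, _, τ, H.pullLs _⟩
  | @pushR A B E S T f g h α e ih =>
      refine .inr ?_
      by_cases hT' : T.NonPos
      · rw [← pushRs_toPath]
        exact .inr ⟨_, _, _, rightFocusable_pushRs (by simp) hT' α _⟩
      -- `T` is a push formula, so the premise is again neutral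
      have hT'' : T.NonNeg := by
        cases T with
        | push => trivial
        | _ => exact (hT' trivial).elim
      obtain h | ⟨X, σ, g', H⟩ | ⟨Y, g', τ, H⟩ := ih hS hT''
      · cases T with
        | push => cases h.2
        | _ => exact (hT' trivial).elim
      · rw [← pushRs_toPath]
        exact .inl ⟨X, σ, _, H.pushRs _⟩
      · obtain ⟨hτ, M, β, e', hM, rfl, H⟩ := H
        subst e'
        exact .inr ⟨Y, g', τ.cons f, by simp, M, β, by simp [← e], hM, rfl, .congr_pushR e H⟩

/-! ### Proofs with equivalent underlying derivations are equal -/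

/-- Side condition for right-focusing, extended to all states: in the locked state `L`, no right
focus may be brought to the root by permutations. -/
def State.AllowsR {A B Y : C} (q : State A B) (g : A ⟶ Y) (τ : Y ⟶ B) : Prop :=
  match q with
  | .foc q => q.AllowsR g τ
  | .inv .left => False
  | .inv _ => True

/-- Side condition for left-focusing, extended to all states: in the locked state `R`, no left
focus may be brought to the root by permutations. -/
def State.AllowsL {A B X : C} (q : State A B) (σ : A ⟶ X) (g : X ⟶ B) : Prop :=
  match q with
  | .foc q => q.AllowsL σ g
  | .inv .right => False
  | .inv _ => True

theorem PreFocus.AllowsLR.allowsR {A B X Y : C} {q : PreFocus A B} {σ : A ⟶ X} {g : X ⟶ Y}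
    {τ : Y ⟶ B} (H : q.AllowsLR σ g τ) : q.AllowsR (σ ≫ g) τ := by
  cases q with
  | left => exact H
  | _ => trivial

theorem PreFocus.AllowsLR.allowsL {A B X Y : C} {q : PreFocus A B} {σ : A ⟶ X} {g : X ⟶ Y}
    {τ : Y ⟶ B} (H : q.AllowsLR σ g τ) : q.AllowsL σ (g ≫ τ) := by
  cases q with
  | right => exact H
  | _ => trivial

theorem PreFocus.allowsLR {A B X Y : C} {q : PreFocus A B} {σ : A ⟶ X} {g : X ⟶ Y}
    {τ : Y ⟶ B} (hL : q.AllowsL σ (g ≫ τ)) (hR : q.AllowsR (σ ≫ g) τ) : q.AllowsLR σ g τ := by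
  cases q with
  | bot => trivial
  | left => exact hR
  | right => exact hL

/-- The side conditions are respected by every right focus that can be brought to the root of the
underlying derivation by permutations, not only by the rule at the root of the proof itself. -/
theorem MaxMult.allowsR (hC : FactorizationPreordered C) {A B Y : C} {q : State A B} {S : Frm p A}
    {T : Frm p B} {h : A ⟶ B} (m : MaxMult q S T h) {g : A ⟶ Y} {τ : Quiver.Path Y B}
    (H : RightFocusable m.toDeriv g τ) : q.AllowsR g (composePath τ) := by
  induction m generalizing Y with
  | ax => exact (not_rightFocusable_atom H).elim
  | inv => trivial
  | invR => trivial
  | invL π hN hP hS e m ih =>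
      subst hS
      rw [toDeriv] at H
      obtain ⟨w, H⟩ := H.of_pushLs
      exact ih H ⟨g, rfl, w.symm⟩
  | focL q σ hσ hP hQ hS e hq m ih =>
      subst hS
      rw [toDeriv] at H
      obtain ⟨l, H⟩ := H.of_pullLs hC
      exact (ih H).elim
  | focR q τ' hτ hN hM hT e hq m ih =>
      subst hT
      rw [toDeriv] at H
      cases H.unique hC (rightFocusable_pushRs hτ hM _ e)
      exact hq
  | focLR q σ τ' hσ hτ hP hN hS hT e hq m ih =>
      subst hS hT
      rw [toDeriv] at H
      cases H.unique hC ((rightFocusable_pushRs hτ hN _ rfl).pullLs e)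
      exact hq.allowsR

/-- The mirror image of `MaxMult.allowsR`. -/
theorem MaxMult.allowsL (hC : FactorizationPreordered C) {A B X : C} {q : State A B} {S : Frm p A}
    {T : Frm p B} {h : A ⟶ B} (m : MaxMult q S T h) {σ : Quiver.Path A X} {g : X ⟶ B}
    (H : LeftFocusable m.toDeriv σ g) : q.AllowsL (composePath σ) g := by
  induction m generalizing X with
  | ax => exact (not_leftFocusable_atom H).elim
  | inv => trivial
  | invL => trivial
  | invR ρ hN hP hT e m ih =>
      subst hT
      rw [toDeriv] at H
      obtain ⟨w, H⟩ := H.of_pullRs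
      exact ih H ⟨g, w.symm, rfl⟩
  | focR q τ hτ hN hM hT e hq m ih =>
      subst hT
      rw [toDeriv] at H
      obtain ⟨l, H⟩ := H.of_pushRs hC
      exact (ih H).elim
  | focL q σ' hσ hP hQ hS e hq m ih =>
      subst hS
      rw [toDeriv] at H
      cases H.unique hC (leftFocusable_pullLs hσ hP _ e)
      exact hq
  | focLR q σ' τ hσ hτ hP hN hS hT e hq m ih =>
      subst hS hT
      rw [toDeriv] at H
      cases H.unique hC (leftFocusable_pullLs hσ hP _ e)
      exact hq.allowsL

/-- Permutations do not affect derivations between atoms, as these are axioms. -/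
theorem eq_of_permEq_of_atom {A B : C} {S : Frm p A} {T : Frm p B} {h : A ⟶ B} {α β : Deriv S T h}
    (H : PermEq α β) {X Y : D} {hX : p.obj X = A} {hY : p.obj Y = B} (hS : S = .atom X hX)
    (hT : T = .atom Y hY) : α = β := by
  induction H with
  | refl => rfl
  | symm _ ih => exact (ih hS hT).symm
  | trans _ _ ih₁ ih₂ => exact (ih₁ hS hT).trans (ih₂ hS hT)
  | congr_pushL => cases hS
  | congr_pushR => cases hT
  | congr_pullL => cases hS
  | congr_pullR => cases hT
  | pullL_pushR => cases hS
  | pushL_pushR => cases hS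
  | pullL_pullR => cases hS
  | pushL_pullR => cases hS

/-- Maximally multifocused proofs in the same state are determined by the permutation class of their
underlying derivation. -/
theorem MaxMult.eq_of_permEq (hC : FactorizationPreordered C) {A B : C} {q : State A B}
    {S : Frm p A} {T : Frm p B} {h : A ⟶ B} (m m' : MaxMult q S T h)
    (H : PermEq m.toDeriv m'.toDeriv) : m = m' := by
  induction m with
  | ax q δ hδ =>
      cases m' with
      | ax _ δ' hδ' =>
          have h' := eq_of_permEq_of_atom H rfl rfl
          rw [toDeriv, toDeriv] at h'
          cases h'
          rfl
      | focL _ σ hσ hP hQ hS => exact (pullSeq_ne_atom hσ hP hS).elim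
      | focR _ τ hτ hN hM hT => exact (pushSeq_ne_atom hτ hT).elim
      | focLR _ σ τ hσ hτ hP hN hS => exact (pullSeq_ne_atom hσ hP hS).elim
  | inv π ρ hN hP hS hT e m ih =>
      cases m' with
      | inv π' ρ' hN' hP' hS' hT' e' m' =>
          subst hS hT
          cases pushSeq_injective hN' hN hS'
          cases pullSeq_injective hP' hP hT'
          subst e e'
          rw [toDeriv, toDeriv] at H
          rw [ih m' (pullRs_cancel ρ (pushLs_cancel π H))]
  | invL π hN hP hS e m ih =>
      cases m' with
      | invL π' hN' hP' hS' e' m' =>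
          subst hS
          cases pushSeq_injective hN' hN hS'
          subst e e'
          rw [toDeriv, toDeriv] at H
          rw [ih m' (pushLs_cancel π H)]
  | invR ρ hN hP hT e m ih =>
      cases m' with
      | invR ρ' hN' hP' hT' e' m' =>
          subst hT
          cases pullSeq_injective hP' hP hT'
          subst e e'
          rw [toDeriv, toDeriv] at H
          rw [ih m' (pullRs_cancel ρ H)]
  | focL q σ hσ hP hQ hS e hq m ih =>
      cases m' with
      | ax => exact (pullSeq_ne_atom hσ hP hS).elim
      | focL _ σ' hσ' hP' hQ' hS' e' hq' m' =>
          subst hS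
          cases pullSeq_injective hP' hP hS'
          rw [toDeriv, toDeriv] at H
          obtain ⟨rfl, H⟩ := pullLs_cancel hC σ H
          rw [ih m' H]
      | focR _ τ hτ hN hM hT e' hq' m' =>
          subst hS hT
          rw [toDeriv, toDeriv] at H
          obtain ⟨l, H'⟩ := ((rightFocusable_pushRs hτ hM _ e').congr H.symm).of_pullLs hC
          exact (m.allowsR hC H').elim
      | focLR _ σ' τ hσ' hτ hP' hN hS' hT e' hq' m' =>
          subst hS hT
          cases pullSeq_injective hP' hP hS'
          rw [toDeriv, toDeriv] at H
          have h' := (rightFocusable_pushRs hτ hN m'.toDeriv rfl).pullLs e'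
          obtain ⟨l, H'⟩ := (h'.congr H.symm).of_pullLs hC
          exact (m.allowsR hC H').elim
  | focR q τ hτ hN hM hT e hq m ih =>
      cases m' with
      | ax => exact (pushSeq_ne_atom hτ hT).elim
      | focR _ τ' hτ' hN' hM' hT' e' hq' m' =>
          subst hT
          cases pushSeq_injective hM' hM hT'
          rw [toDeriv, toDeriv] at H
          obtain ⟨rfl, H⟩ := pushRs_cancel hC τ H
          rw [ih m' H]
      | focL _ σ hσ hP hQ hS e' hq' m' =>
          subst hT hS
          rw [toDeriv, toDeriv] at H
          obtain ⟨l, H'⟩ := ((leftFocusable_pullLs hσ hP _ e').congr H.symm).of_pushRs hC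
          exact (m.allowsL hC H').elim
      | focLR _ σ τ' hσ hτ' hP hN' hS hT' e' hq' m' =>
          subst hT hS
          cases pushSeq_injective hN' hM hT'
          rw [toDeriv, toDeriv] at H
          have h' := leftFocusable_pullLs hσ hP (FreeBif.pushRs τ m'.toDeriv rfl) e'
          obtain ⟨l, H'⟩ := (h'.congr H.symm).of_pushRs hC
          exact (m.allowsL hC H').elim
  | @focLR A B X Y q σ τ P N S T g h hσ hτ hP hN hS hT e hq m ih =>
      cases m' with
      | ax => exact (pullSeq_ne_atom hσ hP hS).elim
      | focL _ σ' hσ' hP' hQ' hS' e' hq' m' =>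
          subst hS hT
          cases pullSeq_injective hP' hP hS'
          rw [toDeriv, toDeriv] at H
          have h' := (rightFocusable_pushRs hτ hN m.toDeriv rfl).pullLs e
          obtain ⟨l, H'⟩ := (h'.congr H).of_pullLs hC
          exact (m'.allowsR hC H').elim
      | focR _ τ' hτ' hN' hM' hT' e' hq' m' =>
          subst hS hT
          cases pushSeq_injective hM' hN hT'
          rw [toDeriv, toDeriv] at H
          have h' := leftFocusable_pullLs hσ hP (FreeBif.pushRs τ m.toDeriv rfl) e
          obtain ⟨l, H'⟩ := (h'.congr H).of_pushRs hC
          exact (m'.allowsL hC H').elim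
      | @focLR _ _ _ _ _ σ' τ' _ _ _ _ g' _ hσ' hτ' hP' hN' hS' hT' e' hq' m' =>
          subst hS hT
          cases pullSeq_injective hP' hP hS'
          cases pushSeq_injective hN' hN hT'
          rw [toDeriv, toDeriv] at H
          obtain ⟨hg, H⟩ := pullLs_cancel hC σ H
          -- `hg` equates composites with `τ`, so the cast along it has to be removed first
          have key : ∀ {k k' : X ⟶ B} (hk : k = k') (w : g ≫ composePath τ = k)
              (w' : g' ≫ composePath τ = k'),
              PermEq (hk ▸ FreeBif.pushRs τ m.toDeriv w) (FreeBif.pushRs τ m'.toDeriv w') →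
              ∃ hg : g = g', PermEq (hg ▸ m.toDeriv) m'.toDeriv := by
            rintro _ _ rfl w w' H
            exact pushRs_cancel hC τ H
          obtain ⟨rfl, H⟩ := key hg rfl rfl H
          rw [ih m' H]

/-! ### Every derivation is equivalent to a maximally multifocused proof -/

/-- A derivation of a neutral sequent comes from a proof in the pre-focus state `q` if all the foci
that can be brought to its root are allowed by `q`. -/
theorem exists_maxMult_foc (hC : FactorizationPreordered C) {A B : C} {S : Frm p A} {T : Frm p B}
    {h : A ⟶ B} (α : Deriv S T h) (q : PreFocus A B) (hS : S.NonPos) (hT : T.NonNeg)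
    (hL : ∀ {X : C} {σ : Quiver.Path A X} {g : X ⟶ B},
      LeftFocusable α σ g → q.AllowsL (composePath σ) g)
    (hR : ∀ {Y : C} {g : A ⟶ Y} {τ : Quiver.Path Y B},
      RightFocusable α g τ → q.AllowsR g (composePath τ)) :
    ∃ m : MaxMult (.foc q) S T h, PermEq α m.toDeriv := by
  induction hn : S.size + T.size using Nat.strong_induction_on generalizing A B with
  | _ n ih =>
  subst hn
  by_cases HL : ∃ (X : C) (σ : Quiver.Path A X) (g : X ⟶ B), LeftFocusable α σ g
  · obtain ⟨X, σ, g, HL⟩ := HL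
    have hL' := hL HL
    obtain ⟨hσ, P, β, e, hP, rfl, Hα⟩ := id HL
    by_cases HR : ∃ (Y : C) (g : A ⟶ Y) (τ : Quiver.Path Y B), RightFocusable α g τ
    · -- both foci are possible, hence they are possible together
      obtain ⟨Y, g', τ, HR⟩ := HR
      have hR' := hR HR
      obtain ⟨hτ, M, β', e', hM, rfl, Hα'⟩ := HR
      obtain ⟨l, γ, w, w', Hβ, -⟩ := exists_of_pullLs_permEq_pushRs hC σ τ (Hα.symm.trans Hα')
      subst w w'
      obtain ⟨X', π, N, hN, rfl⟩ := exists_eq_pushSeq P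
      obtain ⟨Y', ρ, Q, hQ, rfl⟩ := exists_eq_pullSeq M
      obtain ⟨γ₁, H₁⟩ := exists_permEq_pushLs π rfl γ
      obtain ⟨γ₂, H₂⟩ := exists_permEq_pullRs ρ (Category.assoc _ _ _) γ₁
      obtain ⟨m, H₃⟩ := ih _ (by simp only [size_pushSeq, size_pullSeq]; omega) γ₂ .bot hN hQ
        (fun _ => trivial) (fun _ => trivial) rfl
      refine ⟨.focLR q σ τ hσ hτ hP hM rfl rfl e (PreFocus.allowsLR hL' hR')
        (.inv π ρ hN hQ rfl rfl rfl m), Hα.trans (pullLs_congr σ e (Hβ.trans ?_))⟩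
      exact pushRs_congr τ rfl (H₁.trans (pushLs_congr π _
        (H₂.trans (pullRs_congr ρ _ H₃))))
    · obtain ⟨X', π, N, hN, rfl⟩ := exists_eq_pushSeq P
      obtain ⟨γ, H₁⟩ := exists_permEq_pushLs π rfl β
      obtain ⟨m, H₂⟩ := ih _ (by simp only [size_pushSeq, size_pullSeq]; omega) γ
        (.left (composePath π) g) hN hT (fun _ => trivial) (fun H => by
          -- a right focus that permutes below the left phase contradicts `HR`
          rintro ⟨l, rfl, w⟩
          exact HR ⟨_, _, _, ((((H.pushLs rfl w.symm).congr H₁.symm).pullLs e).congr Hα.symm)⟩) rfl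
      exact ⟨.focL q σ hσ hP hT rfl e hL' (.invL π hN hT rfl rfl m),
        Hα.trans (pullLs_congr σ e (H₁.trans (pushLs_congr π rfl H₂)))⟩
  · by_cases HR : ∃ (Y : C) (g : A ⟶ Y) (τ : Quiver.Path Y B), RightFocusable α g τ
    · obtain ⟨Y, g, τ, HR⟩ := HR
      have hR' := hR HR
      obtain ⟨hτ, M, β, e, hM, rfl, Hα⟩ := HR
      obtain ⟨Y', ρ, Q, hQ, rfl⟩ := exists_eq_pullSeq M
      obtain ⟨γ, H₁⟩ := exists_permEq_pullRs ρ rfl β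
      obtain ⟨m, H₂⟩ := ih _ (by simp only [size_pushSeq, size_pullSeq]; omega) γ
        (.right g (composePath ρ)) hS hQ (fun H => by
          -- a left focus that permutes below the right phase contradicts `HL`
          rintro ⟨l, w, rfl⟩
          exact HL ⟨_, _, _, ((((H.pullRs rfl w.symm).congr H₁.symm).pushRs e).congr Hα.symm)⟩)
        (fun _ => trivial) rfl
      exact ⟨.focR q τ hτ hS hM rfl e hR' (.invR ρ hS hQ rfl rfl m),
        Hα.trans (pushRs_congr τ e (H₁.trans (pullRs_congr ρ rfl H₂)))⟩
    · obtain ⟨hS₀, hT₀⟩ | H | H := axiom_or_focusable α hS hT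
      · cases α with
        | ax δ hδ => exact ⟨.ax q δ hδ, .refl _⟩
        | pushR => cases hT₀
        | pullR => cases hT₀
        | _ => cases hS₀
      · exact (HL H).elim
      · exact (HR H).elim

/-- Every permutation class contains the underlying derivation of a proof in the unlocked state. -/
theorem exists_maxMult (hC : FactorizationPreordered C) {A B : C} {S : Frm p A} {T : Frm p B}
    {f : A ⟶ B} (α : Deriv S T f) :
    ∃ m : MaxMult (.inv .unlocked) S T f, PermEq α m.toDeriv := by
  obtain ⟨A', π, N, hN, rfl⟩ := exists_eq_pushSeq S
  obtain ⟨B', ρ, P, hP, rfl⟩ := exists_eq_pullSeq T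
  obtain ⟨β, H₁⟩ := exists_permEq_pushLs π rfl α
  obtain ⟨γ, H₂⟩ := exists_permEq_pullRs ρ (Category.assoc _ _ _) β
  obtain ⟨m, H₃⟩ := exists_maxMult_foc hC γ .bot hN hP (fun _ => trivial) (fun _ => trivial)
  exact ⟨.inv π ρ hN hP rfl rfl rfl m,
    H₁.trans (pushLs_congr π _ (H₂.trans (pullRs_congr ρ _ H₃)))⟩

end FreeBif

theorem mainTheorem3 {C : Type u₁} [Category.{v₁} C] {D : Type u₂} [Category.{v₂} D]
    (p : D ⥤ C) (hC : FactorizationPreordered C) (S T : FreeBif.Bif p)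
    (f : (FreeBif.Bif.proj p).obj S ⟶ (FreeBif.Bif.proj p).obj T) :
    Function.Bijective
      (fun m : FreeBif.MaxMult (.inv .unlocked) S.frm T.frm f =>
        (⟨m.toHom, m.proj_map_toHom⟩ : {α : S ⟶ T // (FreeBif.Bif.proj p).map α = f})) := by
  constructor
  · intro m m' h
    have h' : (⟨f, Quotient.mk _ m.toDeriv⟩ : FreeBif.Bif.Hom S T) =
        ⟨f, Quotient.mk _ m'.toDeriv⟩ := congrArg Subtype.val h
    injection h' with _ h'
    exact m.eq_of_permEq hC m' (Quotient.exact h')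
  · rintro ⟨⟨f', ⟨α⟩⟩, rfl⟩
    obtain ⟨m, H⟩ := FreeBif.exists_maxMult hC α
    exact ⟨m, Subtype.ext (congrArg (FreeBif.Bif.Hom.mk f') (Quotient.sound H.symm))⟩
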